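/- Let $K$ be an algebraically closed field and let $n\ge 2$. Let $B=B(n,1,1,\dots,1)$ be the quiver algebra $KQ/I$, where $Q$ has vertices $1,\dots,n$ and arrows $a_i\colon i\to i+1$ and $b_i\colon i+1\to i$ for $1\le i\le n-1$ (paths are composed from left to right), and $I$ is generated by $b_{n-1}a_{n-1}$ and by $b_{i-1}a_{i-1}-a_ib_i$, $a_{i-1}a_i$, $b_ib_{i-1}$ for $2\le i\le n-1$. Then $B$ has dominant dimension $2n-2$: in a minimal injective resolution $0\to B\to I_0\to I_1\to\cdots$ of the right regular module, $I_0,\dots,I_{2n-3}$ are projective and $I_{2n-2}$ is not. Moreover $B$ belongs to the class $\mathcal A$, that is, $B$ is a finite-dimensional, connected, non-semisimple $K$-algebra such that 1. $B$ is quasi-hereditary: it has finite global dimension, and there is an ordered complete sequence $(e_1,\dots,e_m)$ of primitive orthogonal idempotents, with the modules $e_iB$ pairwise non-isomorphic, such that the right regular module $B_B$ has a finite filtration whose subquotients are isomorphic to proper standard modules $\overline\Delta(i)=e_iB/e_iJ(e_i+e_{i+1}+\cdots+e_m)B$, where $J$ is the Jacobson radical of $B$; 2. $B$ has a simple-preserving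 duality: a contravariant $K$-linear functor $D$ from the category of finite-dimensional right $B$-modules to itself with $D\circ D$ naturally isomorphic to the identity and $D(S)\cong S$ for every simple module $S$; 3. $B$ has dominant dimension at least two. -/

import Mathlib

open CategoryTheory

universe u

/-! Right modules over a ring `A` are modules over the opposite ring `Aᵐᵒᵖ`. -/

section QuiverAlgebra

/-- The arrows of the double of the linear quiver with vertices `0, 1, …, n - 1`:
`a i : i ⟶ i + 1` and `b i : i + 1 ⟶ i` for `0 ≤ i < n - 1`. -/
inductive BArrow (n : ℕ) : Type
  | a (i : Fin (n - 1)) : BArrow n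
  | b (i : Fin (n - 1)) : BArrow n

/-- The vertex at which an arrow starts. -/
def BArrow.source {n : ℕ} : BArrow n → Fin n
  | .a i => ⟨i, by omega⟩
  | .b i => ⟨i + 1, by omega⟩

/-- The vertex at which an arrow ends. -/
def BArrow.target {n : ℕ} : BArrow n → Fin n
  | .a i => ⟨i + 1, by omega⟩
  | .b i => ⟨i, by omega⟩

/-- The free algebra on the vertices and arrows, of which the path algebra is a quotient. -/
abbrev BFree (K : Type u) [Field K] (n : ℕ) : Type u := FreeAlgebra K (Fin n ⊕ BArrow n)

/-- The generator belonging to a vertex (the trivial path). -/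
def BFree.vertex (K : Type u) [Field K] {n : ℕ} (i : Fin n) : BFree K n :=
  FreeAlgebra.ι K (Sum.inl i)

/-- The generator belonging to an arrow. -/
def BFree.arrow (K : Type u) [Field K] {n : ℕ} (x : BArrow n) : BFree K n :=
  FreeAlgebra.ι K (Sum.inr x)

open BFree in
/-- The relations of `B(n, lam_1, …, lam_{n-2})`. The first five families present the path algebra
of the quiver (paths are composed from left to right); the last four generate the ideal of
relations. -/
inductive BRel (K : Type u) [Field K] (n : ℕ) (lam : Fin (n - 2) → K) :
    BFree K n → BFree K n → Prop
  | vertex_idem (i : Fin n) : BRel K n lam (vertex K i * vertex K i) (vertex K i)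
  | vertex_orth (i j : Fin n) (h : i ≠ j) : BRel K n lam (vertex K i * vertex K j) 0
  | vertex_sum : BRel K n lam (∑ i : Fin n, vertex K i) 1
  | source_mul (x : BArrow n) : BRel K n lam (vertex K x.source * arrow K x) (arrow K x)
  | mul_target (x : BArrow n) : BRel K n lam (arrow K x * vertex K x.target) (arrow K x)
  | last (i : Fin (n - 1)) (h : (i : ℕ) + 2 = n) :
      BRel K n lam (arrow K (.b i) * arrow K (.a i)) 0
  | middle (k : Fin (n - 2)) :
      BRel K n lam (arrow K (.b ⟨k, by omega⟩) * arrow K (.a ⟨k, by omega⟩))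
        (lam k • (arrow K (.a ⟨k + 1, by omega⟩) * arrow K (.b ⟨k + 1, by omega⟩)))
  | a_mul_a (k : Fin (n - 2)) :
      BRel K n lam (arrow K (.a ⟨k, by omega⟩) * arrow K (.a ⟨k + 1, by omega⟩)) 0
  | b_mul_b (k : Fin (n - 2)) :
      BRel K n lam (arrow K (.b ⟨k + 1, by omega⟩) * arrow K (.b ⟨k, by omega⟩)) 0

/-- The quiver algebra `B(n, lam_1, …, lam_{n-2})` over `K`. -/
abbrev QuiverAlgebraB (K : Type u) [Field K] (n : ℕ) (lam : Fin (n - 2) → K) : Type u :=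
  RingQuot (BRel K n lam)

end QuiverAlgebra

section DominantDimension

/-- A submodule is essential if it meets every nonzero submodule nontrivially. -/
def IsEssentialSubmodule {R : Type u} [Ring R] {M : Type u} [AddCommGroup M] [Module R M]
    (N : Submodule R M) : Prop :=
  ∀ L : Submodule R M, L ≠ ⊥ → N ⊓ L ≠ ⊥

/-- A minimal injective resolution `0 → M → I 0 → I 1 → ⋯`: an exact sequence with injective terms,
in which the image of every map is essential in its target, so that each `I (i + 1)` is an injective
envelope of the cokernel of the preceding map. -/
structure MinimalInjectiveResolution (R : Type u) [Ring R] (M : Type u) [AddCommGroup M]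
    [Module R M] where
  I : ℕ → ModuleCat.{u} R
  injective : ∀ i, Module.Injective R (I i)
  ι : M →ₗ[R] I 0
  d : ∀ i, I i →ₗ[R] I (i + 1)
  ι_injective : Function.Injective ι
  exact_zero : Function.Exact ι (d 0)
  exact_succ : ∀ i, Function.Exact (d i) (d (i + 1))
  essential_zero : IsEssentialSubmodule (LinearMap.range ι)
  essential_succ : ∀ i, IsEssentialSubmodule (LinearMap.range (d i))

/-- The dominant dimension of a module: the supremum of all `k` such that the first `k` terms
`I 0, …, I (k - 1)` of a minimal injective resolution are projective. -/
noncomputable def moduleDominantDimension (R : Type u) [Ring R] (M : Type u) [AddCommGroup M]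
    [Module R M] : ℕ∞ :=
  ⨆ (I : MinimalInjectiveResolution R M) (k : ℕ) (_ : ∀ i < k, Module.Projective R (I.I i)),
    (k : ℕ∞)

/-- The dominant dimension of a ring `A`: that of the right regular module. -/
noncomputable def dominantDimension (A : Type u) [Ring A] : ℕ∞ :=
  moduleDominantDimension Aᵐᵒᵖ A

end DominantDimension

section QuasiHereditary

/-- A nonzero idempotent that is not a sum of two nonzero orthogonal idempotents. -/
def IsPrimitiveIdempotentElem {A : Type u} [Ring A] (e : A) : Prop :=
  IsIdempotentElem e ∧ e ≠ 0 ∧ ∀ f g : A, IsIdempotentElem f → IsIdempotentElem g →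
    f * g = 0 → g * f = 0 → e = f + g → f = 0 ∨ g = 0

/-- The right ideal `e A`, as a right module. -/
abbrev rightIdeal {A : Type u} [Ring A] (e : A) : Submodule Aᵐᵒᵖ A :=
  Submodule.span Aᵐᵒᵖ {e}

/-- The right ideal `e_i J (e_i + e_{i+1} + ⋯ + e_{m-1}) A`, where `J` is the Jacobson radical. -/
def properStandardKernel {A : Type u} [Ring A] {m : ℕ} (e : Fin m → A) (i : Fin m) :
    Submodule Aᵐᵒᵖ A :=
  Submodule.span Aᵐᵒᵖ {x | ∃ j ∈ Ring.jacobson A, x = e i * j * ∑ k ∈ Finset.Ici i, e k}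

/-- The proper standard right module `e_i A / e_i J (e_i + e_{i+1} + ⋯ + e_{m-1}) A`. -/
abbrev ProperStandard {A : Type u} [Ring A] {m : ℕ} (e : Fin m → A) (i : Fin m) : Type u :=
  rightIdeal (e i) ⧸ (properStandardKernel e i).submoduleOf (rightIdeal (e i))

/-- `M` has a finite filtration all of whose subquotients are isomorphic to modules of the family
`X`. -/
def HasFiltrationBy {R : Type u} [Ring R] {ι : Type} (X : ι → ModuleCat.{u} R) (M : Type u)
    [AddCommGroup M] [Module R M] : Prop :=
  ∃ (l : ℕ) (F : ℕ → Submodule R M), Monotone F ∧ F 0 = ⊥ ∧ F l = ⊤ ∧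
    ∀ k < l, ∃ i, Nonempty ((F (k + 1) ⧸ (F k).submoduleOf (F (k + 1))) ≃ₗ[R] X i)

/-- An ordered complete sequence of primitive orthogonal idempotents of a basic algebra: the
modules `e_i A` are pairwise nonisomorphic. -/
structure IsIdempotentSequence {A : Type u} [Ring A] {m : ℕ} (e : Fin m → A) : Prop where
  complete : CompleteOrthogonalIdempotents e
  primitive : ∀ i, IsPrimitiveIdempotentElem (e i)
  basic : ∀ i j, Nonempty (rightIdeal (e i) ≃ₗ[Aᵐᵒᵖ] rightIdeal (e j)) → i = j

/-- `A` with the ordered sequence `e` is standardly stratified: the right regular module is filtered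
by proper standard modules. -/
def IsStandardlyStratified {A : Type u} [Ring A] {m : ℕ} (e : Fin m → A) : Prop :=
  HasFiltrationBy (fun i => ModuleCat.of Aᵐᵒᵖ (ProperStandard e i)) A

/-- The projective dimensions of the finitely generated right modules are bounded. -/
def HasFiniteGlobalDimension (A : Type u) [Ring A] : Prop :=
  ∃ d : ℕ, ∀ M : ModuleCat.{u} Aᵐᵒᵖ, Module.Finite Aᵐᵒᵖ M → HasProjectiveDimensionLE M d

/-- A (basic) algebra is quasi-hereditary if it is standardly stratified for some ordered complete
sequence of primitive orthogonal idempotents and has finite global dimension. -/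
def IsQuasiHereditary (A : Type u) [Ring A] : Prop :=
  (∃ (m : ℕ) (e : Fin m → A), IsIdempotentSequence e ∧ IsStandardlyStratified e) ∧
    HasFiniteGlobalDimension A

end QuasiHereditary

section ClassA

/-- A simple-preserving duality on the category of finitely generated right `A`-modules: a
contravariant `K`-linear functor `D` with `D ∘ D` naturally isomorphic to the identity and with
`D S ≅ S` for every simple module `S`. -/
structure IsSimplePreservingDuality (K : Type u) [Field K] (A : Type u) [Ring A] [Algebra K A]
    (D : (FGModuleCat.{u} Aᵐᵒᵖ)ᵒᵖ ⥤ FGModuleCat.{u} Aᵐᵒᵖ) : Prop where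
  map_add : ∀ {M N : FGModuleCat.{u} Aᵐᵒᵖ} (f g : M ⟶ N),
    D.map (f + g).op = D.map f.op + D.map g.op
  map_smul : ∀ {M N : FGModuleCat.{u} Aᵐᵒᵖ} (c : K) (f : M ⟶ N),
    D.map (c • f).op = c • D.map f.op
  involutive : Nonempty (D.rightOp ⋙ D ≅ 𝟭 (FGModuleCat.{u} Aᵐᵒᵖ))
  simple : ∀ S : FGModuleCat.{u} Aᵐᵒᵖ, IsSimpleModule Aᵐᵒᵖ S → Nonempty (D.obj (.op S) ≅ S)

/-- Class `𝒜`: finite dimensional, connected, non-semisimple `K`-algebras that are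
quasi-hereditary, have a simple-preserving duality, and have dominant dimension at least two. -/
structure IsInClassA (K : Type u) [Field K] (A : Type u) [Ring A] [Algebra K A] : Prop where
  finiteDimensional : FiniteDimensional K A
  nontrivial : Nontrivial A
  connected : ∀ c ∈ Set.center A, IsIdempotentElem c → c = 0 ∨ c = 1
  not_semisimple : ¬ IsSemisimpleRing A
  quasiHereditary : IsQuasiHereditary A
  duality : ∃ D : (FGModuleCat.{u} Aᵐᵒᵖ)ᵒᵖ ⥤ FGModuleCat.{u} Aᵐᵒᵖ, IsSimplePreservingDuality K A D
  two_le_dominantDimension : 2 ≤ dominantDimension A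

end ClassA

/-!
Vertices are numbered from `0` to `n - 1`. The algebra has the basis consisting of the trivial
paths `E i`, the arrows `a i : i ⟶ i + 1` and `b i : i + 1 ⟶ i`, and the loops `c i = a i * b i`,
where `b i * a i = c (i + 1)`; everything indexed outside the quiver is zero, so the relation at
the last vertex is the case `c (n - 1) = 0` of this formula. That these elements span follows from
the relations, and they are independent because they act correctly on an explicit algebra, the
`ZigzagModel`. The resulting isomorphism is `QuiverAlgebraB.coordinates`, and the rest works in
any algebra `A` with such coordinates. The radical is the span of all arrows and loops, and its
cube is zero.

*Dominant dimension.* The injective right modules are the duals `T i` of the left modules `A E i`,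
and right multiplication `A E j → A E i` by an element of `E j A E i` induces a map `T i → T j`.
With `f = 1 - E (n - 1)`, the minimal injective resolution of `A` is

`0 → A → D(Af) × T (n - 2) → T (n - 3) → ⋯ → T 0 → T 0 → T 1 → ⋯ → T (n - 2) → T (n - 1) → 0`

where the maps are induced by `a (n - 3), …, a 0`, then by `c 0`, then by `b 0, …, b (n - 2)`.
Exactness is read off from the coordinates. All these maps are induced by radical elements, so the
kernel of each contains the socle of its source; as the radical is nilpotent, a submodule
containing the socle is essential, and the resolution is minimal (`resolution`). The form
`(x, y) ↦ trace (x * y)`, where `trace` sums the coefficients of the loops, identifies `f A` with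
`D(Af)`. Hence `D(Af)` and its summands `T 0, …, T (n - 2)` are projective, whereas `T (n - 1)`, a
proper quotient of the indecomposable `T (n - 2)`, is not (`projective_dualOf_f`,
`not_projective_T`). It stands in degree `2 n - 2`. Since minimal injective resolutions are unique
(`MinimalInjectiveResolution.exists_equiv`), this gives the dominant dimension.

*Global dimension.* Left multiplication by `a i` gives the exact sequences
`0 → a (i + 1) A → E (i + 1) A → a i A → 0`, which bound the projective dimension of `a i A` by
descending induction on `i`; then `0 → a 0 A → E 0 A → c 0 A → 0` bounds that of the simple module
`c 0 A` at `0`, and `0 → c i A → a i A → S (i + 1) → 0` those of the other simple modules by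
ascending induction (`projDimLE_of_isSimpleAt`).

*Stratification.* The proper standard module at `i` is `E i A / a i A`, and `a i A` is isomorphic
to the one at `i + 1`, or zero for `i = n - 1`. So each `E i A` has a
filtration of length at most two by proper standard modules (`isStandardlyStratified`).

*Duality.* The anti-involution that fixes every `E i` and exchanges `a i` and `b i` turns the dual
of a right module, which is a left module, into a right module. As it fixes the trivial paths,
every simple module is preserved (`isSimplePreservingDuality`).
-/

/-! ### An explicit model of the algebra -/

/-- The quadruples `(e, a, b, c)` of sequences with `e` supported on the vertices `i < n`, and `a`,
`b`, `c` on the indices `i` with `i + 1 < n`. Sequences indexed by `ℕ` rather than `Fin` avoid casts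
between the index ranges of vertices and arrows. -/
def zigzagSubmodule (K : Type u) [Field K] (n : ℕ) :
    Submodule K ((ℕ → K) × (ℕ → K) × (ℕ → K) × (ℕ → K)) where
  carrier := {v | (∀ i, n ≤ i → v.1 i = 0) ∧ (∀ i, n ≤ i + 1 → v.2.1 i = 0) ∧
    (∀ i, n ≤ i + 1 → v.2.2.1 i = 0) ∧ (∀ i, n ≤ i + 1 → v.2.2.2 i = 0)}
  add_mem' := by
    rintro v w ⟨h1, h2, h3, h4⟩ ⟨k1, k2, k3, k4⟩
    refine ⟨fun i hi => ?_, fun i hi => ?_, fun i hi => ?_, fun i hi => ?_⟩ <;> simp_all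
  zero_mem' := by simp
  smul_mem' := by
    rintro r v ⟨h1, h2, h3, h4⟩
    refine ⟨fun i hi => ?_, fun i hi => ?_, fun i hi => ?_, fun i hi => ?_⟩ <;> simp_all

/-- The algebra with a basis of trivial paths, arrows `a i`, `b i` and loops `c i`, given by its
coordinate vectors. A separate type is needed, since the product is not the one of the sequences. -/
def ZigzagModel (K : Type u) [Field K] (n : ℕ) : Type u := zigzagSubmodule K n

namespace ZigzagModel

variable {K : Type u} [Field K] {n : ℕ}

instance : AddCommGroup (ZigzagModel K n) := inferInstanceAs (AddCommGroup (zigzagSubmodule K n))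

instance : Module K (ZigzagModel K n) := inferInstanceAs (Module K (zigzagSubmodule K n))

/-- Coordinates at the trivial paths. -/
def e (v : ZigzagModel K n) (i : ℕ) : K := v.1.1 i
/-- Coordinates at the arrows `a i`. -/
def a (v : ZigzagModel K n) (i : ℕ) : K := v.1.2.1 i
/-- Coordinates at the arrows `b i`. -/
def b (v : ZigzagModel K n) (i : ℕ) : K := v.1.2.2.1 i
/-- Coordinates at the loops `c i = a i * b i`. -/
def c (v : ZigzagModel K n) (i : ℕ) : K := v.1.2.2.2 i

/-- The vector with prescribed coordinates, which are cut off outside the range of the basis. -/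
def mk (e a b c : ℕ → K) : ZigzagModel K n :=
  ⟨(fun i => if i < n then e i else 0, fun i => if i + 1 < n then a i else 0,
    fun i => if i + 1 < n then b i else 0, fun i => if i + 1 < n then c i else 0),
    fun i hi => if_neg (by omega), fun i hi => if_neg (by omega), fun i hi => if_neg (by omega),
    fun i hi => if_neg (by omega)⟩

variable (v w : ZigzagModel K n) (r : K) (i : ℕ)

lemma e_eq_zero (h : n ≤ i) : v.e i = 0 := v.2.1 i h
lemma a_eq_zero (h : n ≤ i + 1) : v.a i = 0 := v.2.2.1 i h
lemma b_eq_zero (h : n ≤ i + 1) : v.b i = 0 := v.2.2.2.1 i h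
lemma c_eq_zero (h : n ≤ i + 1) : v.c i = 0 := v.2.2.2.2 i h

@[simp] lemma e_add : (v + w).e i = v.e i + w.e i := rfl
@[simp] lemma a_add : (v + w).a i = v.a i + w.a i := rfl
@[simp] lemma b_add : (v + w).b i = v.b i + w.b i := rfl
@[simp] lemma c_add : (v + w).c i = v.c i + w.c i := rfl
@[simp] lemma e_zero : (0 : ZigzagModel K n).e i = 0 := rfl
@[simp] lemma a_zero : (0 : ZigzagModel K n).a i = 0 := rfl
@[simp] lemma b_zero : (0 : ZigzagModel K n).b i = 0 := rfl
@[simp] lemma c_zero : (0 : ZigzagModel K n).c i = 0 := rfl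
@[simp] lemma e_smul : (r • v).e i = r * v.e i := rfl
@[simp] lemma a_smul : (r • v).a i = r * v.a i := rfl
@[simp] lemma b_smul : (r • v).b i = r * v.b i := rfl
@[simp] lemma c_smul : (r • v).c i = r * v.c i := rfl

variable (e' a' b' c' : ℕ → K)

@[simp] lemma e_mk : (mk e' a' b' c' : ZigzagModel K n).e i = if i < n then e' i else 0 := rfl
@[simp] lemma a_mk : (mk e' a' b' c' : ZigzagModel K n).a i = if i + 1 < n then a' i else 0 := rfl
@[simp] lemma b_mk : (mk e' a' b' c' : ZigzagModel K n).b i = if i + 1 < n then b' i else 0 := rfl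
@[simp] lemma c_mk : (mk e' a' b' c' : ZigzagModel K n).c i = if i + 1 < n then c' i else 0 := rfl

variable {v w}

@[ext] lemma ext (he : ∀ i < n, v.e i = w.e i) (ha : ∀ i, i + 1 < n → v.a i = w.a i)
    (hb : ∀ i, i + 1 < n → v.b i = w.b i) (hc : ∀ i, i + 1 < n → v.c i = w.c i) : v = w := by
  have h1 : v.1.1 = w.1.1 := funext fun i => by
    by_cases h : i < n
    · exact he i h
    · exact (v.e_eq_zero i (by omega)).trans (w.e_eq_zero i (by omega)).symm
  have h2 : v.1.2.1 = w.1.2.1 := funext fun i => by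
    by_cases h : i + 1 < n
    · exact ha i h
    · exact (v.a_eq_zero i (by omega)).trans (w.a_eq_zero i (by omega)).symm
  have h3 : v.1.2.2.1 = w.1.2.2.1 := funext fun i => by
    by_cases h : i + 1 < n
    · exact hb i h
    · exact (v.b_eq_zero i (by omega)).trans (w.b_eq_zero i (by omega)).symm
  have h4 : v.1.2.2.2 = w.1.2.2.2 := funext fun i => by
    by_cases h : i + 1 < n
    · exact hc i h
    · exact (v.c_eq_zero i (by omega)).trans (w.c_eq_zero i (by omega)).symm
  exact Subtype.ext (Prod.ext h1 (Prod.ext h2 (Prod.ext h3 h4)))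

/-- The contribution of the products `b (i - 1) * a (i - 1) = c i` to the `i`-th loop coordinate of
a product; at the vertex `0` there is none. -/
def back (x y : ℕ → K) : ℕ → K
  | 0 => 0
  | i + 1 => x i * y i

@[simp] lemma back_zero (x y : ℕ → K) : back x y 0 = 0 := rfl
@[simp] lemma back_succ (x y : ℕ → K) : back x y (i + 1) = x i * y i := rfl

instance : Mul (ZigzagModel K n) where
  mul v w := mk (fun i => v.e i * w.e i) (fun i => v.e i * w.a i + v.a i * w.e (i + 1))
    (fun i => v.e (i + 1) * w.b i + v.b i * w.e i)
    (fun i => v.e i * w.c i + v.c i * w.e i + v.a i * w.b i + back v.b w.a i)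

instance : One (ZigzagModel K n) where
  one := mk 1 0 0 0

variable (v w)

@[simp] lemma e_mul : (v * w).e i = v.e i * w.e i := by
  change (if i < n then _ else _) = _
  split_ifs with h
  · rfl
  · rw [v.e_eq_zero i (by omega), zero_mul]

@[simp] lemma a_mul : (v * w).a i = v.e i * w.a i + v.a i * w.e (i + 1) := by
  change (if i + 1 < n then _ else _) = _
  split_ifs with h
  · rfl
  · rw [v.a_eq_zero i (by omega), w.a_eq_zero i (by omega), zero_mul, mul_zero, add_zero]

@[simp] lemma b_mul : (v * w).b i = v.e (i + 1) * w.b i + v.b i * w.e i := by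
  change (if i + 1 < n then _ else _) = _
  split_ifs with h
  · rfl
  · rw [v.b_eq_zero i (by omega), w.b_eq_zero i (by omega), zero_mul, mul_zero, add_zero]

lemma c_mul (h : i + 1 < n) :
    (v * w).c i = v.e i * w.c i + v.c i * w.e i + v.a i * w.b i + back v.b w.a i :=
  if_pos h

lemma e_one (h : i < n) : (1 : ZigzagModel K n).e i = 1 := if_pos h
@[simp] lemma a_one : (1 : ZigzagModel K n).a i = 0 := ite_self 0
@[simp] lemma b_one : (1 : ZigzagModel K n).b i = 0 := ite_self 0
@[simp] lemma c_one : (1 : ZigzagModel K n).c i = 0 := ite_self 0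

instance : Ring (ZigzagModel K n) where
  __ := (inferInstance : AddCommGroup (ZigzagModel K n))
  mul_assoc x y z := by
    ext i hi
    · simp [mul_assoc]
    · simp; ring
    · simp; ring
    · simp only [c_mul _ _ _ hi]
      cases i <;> simp <;> ring
  one_mul x := by
    ext i hi
    · simp [e_one, hi]
    · simp [e_one, show i < n by omega]
    · simp [e_one, hi]
    · rw [c_mul _ _ _ hi]
      cases i <;> simp [e_one, show 0 < n by omega, show _ < n from Nat.lt_of_succ_lt hi]
  mul_one x := by
    ext i hi
    · simp [e_one, hi]
    · simp [e_one, hi]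
    · simp [e_one, show i < n by omega]
    · rw [c_mul _ _ _ hi]
      cases i <;> simp [e_one, show 0 < n by omega, show _ < n from Nat.lt_of_succ_lt hi]
  left_distrib x y z := by
    ext i hi
    · simp [mul_add]
    · simp; ring
    · simp; ring
    · simp only [c_mul _ _ _ hi, c_add]
      cases i <;> simp <;> ring
  right_distrib x y z := by
    ext i hi
    · simp [add_mul]
    · simp; ring
    · simp; ring
    · simp only [c_mul _ _ _ hi, c_add]
      cases i <;> simp <;> ring
  zero_mul x := by
    ext i hi
    · simp
    · simp
    · simp
    · rw [c_mul _ _ _ hi]; cases i <;> simp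
  mul_zero x := by
    ext i hi
    · simp
    · simp
    · simp
    · rw [c_mul _ _ _ hi]; cases i <;> simp

instance : Algebra K (ZigzagModel K n) := Algebra.ofModule
  (fun r x y => by
    ext i hi
    · simp [mul_assoc]
    · simp; ring
    · simp; ring
    · simp only [c_mul _ _ _ hi, c_smul]
      cases i <;> simp <;> ring)
  (fun r x y => by
    ext i hi
    · simp; ring
    · simp; ring
    · simp; ring
    · simp only [c_mul _ _ _ hi, c_smul]
      cases i <;> simp <;> ring)

end ZigzagModel

/-! ### Algebras with coordinates -/

/-- Coordinates on an algebra: an isomorphism with the model. Equivalently, a basis of elements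
`E i`, `a i`, `b i`, `c i` that multiply like paths in the quiver algebra. -/
abbrev ZigzagCoordinates (K : Type u) [Field K] (n : ℕ) (A : Type u) [Ring A] [Algebra K A] :
    Type u :=
  A ≃ₐ[K] ZigzagModel K n

namespace ZigzagCoordinates

variable {K : Type u} [Field K] {n : ℕ} {A : Type u} [Ring A] [Algebra K A]
  (Z : ZigzagCoordinates K n A)

/-- The coefficient at the trivial path of a vertex. -/
def ε (i : ℕ) : Module.Dual K A where
  toFun x := (Z x).e i
  map_add' x y := by simp
  map_smul' r x := by simp

/-- The coefficient at the arrow `a i`. -/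
def α (i : ℕ) : Module.Dual K A where
  toFun x := (Z x).a i
  map_add' x y := by simp
  map_smul' r x := by simp

/-- The coefficient at the arrow `b i`. -/
def β (i : ℕ) : Module.Dual K A where
  toFun x := (Z x).b i
  map_add' x y := by simp
  map_smul' r x := by simp

/-- The coefficient at the loop `c i`. -/
def γ (i : ℕ) : Module.Dual K A where
  toFun x := (Z x).c i
  map_add' x y := by simp
  map_smul' r x := by simp

/-- The element with given coordinates. -/
def mk (e a b c : ℕ → K) : A := Z.symm (ZigzagModel.mk e a b c)

/-- The trivial path at a vertex, `0` for `n ≤ i`. -/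
def E (i : ℕ) : A := Z.mk (Pi.single i 1) 0 0 0
/-- The arrow `i ⟶ i + 1`, `0` for `n ≤ i + 1`. -/
def a (i : ℕ) : A := Z.mk 0 (Pi.single i 1) 0 0
/-- The arrow `i + 1 ⟶ i`, `0` for `n ≤ i + 1`. -/
def b (i : ℕ) : A := Z.mk 0 0 (Pi.single i 1) 0
/-- The loop `a i * b i`, `0` for `n ≤ i + 1`. -/
def c (i : ℕ) : A := Z.mk 0 0 0 (Pi.single i 1)

variable (i j : ℕ) (x y : A)

lemma ε_eq_zero (h : n ≤ i) : Z.ε i x = 0 := (Z x).e_eq_zero i h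
lemma α_eq_zero (h : n ≤ i + 1) : Z.α i x = 0 := (Z x).a_eq_zero i h
lemma β_eq_zero (h : n ≤ i + 1) : Z.β i x = 0 := (Z x).b_eq_zero i h
lemma γ_eq_zero (h : n ≤ i + 1) : Z.γ i x = 0 := (Z x).c_eq_zero i h

variable {x y} in
lemma ext (he : ∀ i < n, Z.ε i x = Z.ε i y) (ha : ∀ i, i + 1 < n → Z.α i x = Z.α i y)
    (hb : ∀ i, i + 1 < n → Z.β i x = Z.β i y) (hc : ∀ i, i + 1 < n → Z.γ i x = Z.γ i y) : x = y :=
  Z.injective (ZigzagModel.ext he ha hb hc)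

variable {x y} in
lemma ext' (h : ∀ i, Z.ε i x = Z.ε i y ∧ Z.α i x = Z.α i y ∧ Z.β i x = Z.β i y ∧
    Z.γ i x = Z.γ i y) : x = y :=
  Z.ext (fun i _ => (h i).1) (fun i _ => (h i).2.1) (fun i _ => (h i).2.2.1)
    (fun i _ => (h i).2.2.2)

lemma ε_mul : Z.ε i (x * y) = Z.ε i x * Z.ε i y := by simp [ε]
lemma α_mul : Z.α i (x * y) = Z.ε i x * Z.α i y + Z.α i x * Z.ε (i + 1) y := by simp [ε, α]
lemma β_mul : Z.β i (x * y) = Z.ε (i + 1) x * Z.β i y + Z.β i x * Z.ε i y := by simp [ε, β]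
lemma γ_mul (h : i + 1 < n) : Z.γ i (x * y) = Z.ε i x * Z.γ i y + Z.γ i x * Z.ε i y +
    Z.α i x * Z.β i y + ZigzagModel.back (Z.β · x) (Z.α · y) i := by
  simp only [γ, LinearMap.coe_mk, AddHom.coe_mk, map_mul, ZigzagModel.c_mul _ _ _ h]
  rfl

lemma ε_one (h : i < n) : Z.ε i 1 = 1 := by simp [ε, ZigzagModel.e_one, h]
@[simp] lemma α_one : Z.α i 1 = 0 := by simp [α]
@[simp] lemma β_one : Z.β i 1 = 0 := by simp [β]
@[simp] lemma γ_one : Z.γ i 1 = 0 := by simp [γ]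

section mk
variable (e' a' b' c' : ℕ → K)

@[simp] lemma ε_mk : Z.ε i (Z.mk e' a' b' c') = if i < n then e' i else 0 := by simp [ε, mk]
@[simp] lemma α_mk : Z.α i (Z.mk e' a' b' c') = if i + 1 < n then a' i else 0 := by simp [α, mk]
@[simp] lemma β_mk : Z.β i (Z.mk e' a' b' c') = if i + 1 < n then b' i else 0 := by simp [β, mk]
@[simp] lemma γ_mk : Z.γ i (Z.mk e' a' b' c') = if i + 1 < n then c' i else 0 := by simp [γ, mk]

end mk

@[simp] lemma ε_E : Z.ε j (Z.E i) = if j = i ∧ i < n then 1 else 0 := by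
  simp only [E, ε_mk, Pi.single_apply, ← ite_and]; congr 1; grind
@[simp] lemma α_E : Z.α j (Z.E i) = 0 := by simp [E]
@[simp] lemma β_E : Z.β j (Z.E i) = 0 := by simp [E]
@[simp] lemma γ_E : Z.γ j (Z.E i) = 0 := by simp [E]
@[simp] lemma ε_a : Z.ε j (Z.a i) = 0 := by simp [a]
@[simp] lemma α_a : Z.α j (Z.a i) = if j = i ∧ i + 1 < n then 1 else 0 := by
  simp only [a, α_mk, Pi.single_apply, ← ite_and]; congr 1; grind
@[simp] lemma β_a : Z.β j (Z.a i) = 0 := by simp [a]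
@[simp] lemma γ_a : Z.γ j (Z.a i) = 0 := by simp [a]
@[simp] lemma ε_b : Z.ε j (Z.b i) = 0 := by simp [b]
@[simp] lemma α_b : Z.α j (Z.b i) = 0 := by simp [b]
@[simp] lemma β_b : Z.β j (Z.b i) = if j = i ∧ i + 1 < n then 1 else 0 := by
  simp only [b, β_mk, Pi.single_apply, ← ite_and]; congr 1; grind
@[simp] lemma γ_b : Z.γ j (Z.b i) = 0 := by simp [b]
@[simp] lemma ε_c : Z.ε j (Z.c i) = 0 := by simp [c]
@[simp] lemma α_c : Z.α j (Z.c i) = 0 := by simp [c]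
@[simp] lemma β_c : Z.β j (Z.c i) = 0 := by simp [c]
@[simp] lemma γ_c : Z.γ j (Z.c i) = if j = i ∧ i + 1 < n then 1 else 0 := by
  simp only [c, γ_mk, Pi.single_apply, ← ite_and]; congr 1; grind

section
variable {Z j x}

lemma γ_mul_zero : Z.γ 0 (x * y) = if 1 < n then Z.ε 0 x * Z.γ 0 y + Z.γ 0 x * Z.ε 0 y +
    Z.α 0 x * Z.β 0 y else 0 := by
  split_ifs with h
  · simp [γ_mul, h]
  · exact Z.γ_eq_zero _ _ (by omega)

lemma γ_mul_succ : Z.γ (j + 1) (x * y) = if j + 2 < n then Z.ε (j + 1) x * Z.γ (j + 1) y +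
    Z.γ (j + 1) x * Z.ε (j + 1) y + Z.α (j + 1) x * Z.β (j + 1) y + Z.β j x * Z.α j y else 0 := by
  split_ifs with h
  · simp [γ_mul, h]
  · exact Z.γ_eq_zero _ _ (by omega)

end

@[simp] lemma ε_E_mul : Z.ε j (Z.E i * x) = if j = i then Z.ε j x else 0 := by
  have := Z.ε_eq_zero j x
  rw [ε_mul]; simp; grind
@[simp] lemma α_E_mul : Z.α j (Z.E i * x) = if j = i then Z.α j x else 0 := by
  have := Z.α_eq_zero j x
  rw [α_mul]; simp; grind
@[simp] lemma β_E_mul : Z.β j (Z.E i * x) = if j + 1 = i then Z.β j x else 0 := by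
  have := Z.β_eq_zero j x
  rw [β_mul]; simp; grind
@[simp] lemma γ_E_mul : Z.γ j (Z.E i * x) = if j = i then Z.γ j x else 0 := by
  have := Z.γ_eq_zero j x
  cases j <;> simp [γ_mul_zero, γ_mul_succ] <;> grind

@[simp] lemma ε_mul_E : Z.ε j (x * Z.E i) = if j = i then Z.ε j x else 0 := by
  have := Z.ε_eq_zero j x
  rw [ε_mul]; simp; grind
@[simp] lemma α_mul_E : Z.α j (x * Z.E i) = if j + 1 = i then Z.α j x else 0 := by
  have := Z.α_eq_zero j x
  rw [α_mul]; simp; grind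
@[simp] lemma β_mul_E : Z.β j (x * Z.E i) = if j = i then Z.β j x else 0 := by
  have := Z.β_eq_zero j x
  rw [β_mul]; simp; grind
@[simp] lemma γ_mul_E : Z.γ j (x * Z.E i) = if j = i then Z.γ j x else 0 := by
  have := Z.γ_eq_zero j x
  cases j <;> simp [γ_mul_zero, γ_mul_succ] <;> grind

@[simp] lemma ε_a_mul : Z.ε j (Z.a i * x) = 0 := by simp [ε_mul]
@[simp] lemma α_a_mul : Z.α j (Z.a i * x) = if j = i then Z.ε (j + 1) x else 0 := by
  have := Z.ε_eq_zero (j + 1) x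
  rw [α_mul]; simp; grind
@[simp] lemma β_a_mul : Z.β j (Z.a i * x) = 0 := by simp [β_mul]
@[simp] lemma γ_a_mul : Z.γ j (Z.a i * x) = if j = i then Z.β j x else 0 := by
  have := Z.β_eq_zero j x
  cases j <;> simp [γ_mul_zero, γ_mul_succ] <;> grind

@[simp] lemma ε_mul_a : Z.ε j (x * Z.a i) = 0 := by simp [ε_mul]
@[simp] lemma α_mul_a : Z.α j (x * Z.a i) = if j = i ∧ j + 1 < n then Z.ε j x else 0 := by
  rw [α_mul]; simp; grind
@[simp] lemma β_mul_a : Z.β j (x * Z.a i) = 0 := by simp [β_mul]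
@[simp] lemma γ_mul_a : Z.γ j (x * Z.a i) = if j = i + 1 ∧ j + 1 < n then Z.β i x else 0 := by
  cases j <;> simp [γ_mul_zero, γ_mul_succ]; grind

@[simp] lemma γ_b_mul : Z.γ j (Z.b i * x) = if j = i + 1 ∧ j + 1 < n then Z.α i x else 0 := by
  cases j <;> simp [γ_mul_zero, γ_mul_succ]; grind

@[simp] lemma ε_mul_b : Z.ε j (x * Z.b i) = 0 := by simp [ε_mul]
@[simp] lemma α_mul_b : Z.α j (x * Z.b i) = 0 := by simp [α_mul]
@[simp] lemma β_mul_b : Z.β j (x * Z.b i) = if j = i then Z.ε (j + 1) x else 0 := by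
  have := Z.ε_eq_zero (j + 1) x
  rw [β_mul]; simp; grind
@[simp] lemma γ_mul_b : Z.γ j (x * Z.b i) = if j = i then Z.α j x else 0 := by
  have := Z.α_eq_zero j x
  cases j <;> simp [γ_mul_zero, γ_mul_succ] <;> grind

@[simp] lemma ε_c_mul : Z.ε j (Z.c i * x) = 0 := by simp [ε_mul]
@[simp] lemma α_c_mul : Z.α j (Z.c i * x) = 0 := by simp [α_mul]
@[simp] lemma β_c_mul : Z.β j (Z.c i * x) = 0 := by simp [β_mul]
@[simp] lemma γ_c_mul : Z.γ j (Z.c i * x) = if j = i ∧ j + 1 < n then Z.ε j x else 0 := by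
  cases j <;> simp [γ_mul_zero, γ_mul_succ] <;> grind

@[simp] lemma ε_mul_c : Z.ε j (x * Z.c i) = 0 := by simp [ε_mul]
@[simp] lemma α_mul_c : Z.α j (x * Z.c i) = 0 := by simp [α_mul]
@[simp] lemma β_mul_c : Z.β j (x * Z.c i) = 0 := by simp [β_mul]
@[simp] lemma γ_mul_c : Z.γ j (x * Z.c i) = if j = i ∧ j + 1 < n then Z.ε j x else 0 := by
  cases j <;> simp [γ_mul_zero, γ_mul_succ] <;> grind

lemma E_mul_E : Z.E i * Z.E j = if i = j then Z.E i else 0 := by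
  refine Z.ext' fun k => ?_
  split_ifs <;> simp <;> grind
@[simp] lemma E_mul_E_self : Z.E i * Z.E i = Z.E i := by simp [E_mul_E]
@[simp] lemma E_mul_a : Z.E i * Z.a i = Z.a i := by
  refine Z.ext' fun k => ?_; simp; grind
@[simp] lemma a_mul_E : Z.a i * Z.E (i + 1) = Z.a i := by
  refine Z.ext' fun k => ?_; simp; grind
@[simp] lemma E_mul_b : Z.E (i + 1) * Z.b i = Z.b i := by
  refine Z.ext' fun k => ?_; simp; grind
@[simp] lemma b_mul_E : Z.b i * Z.E i = Z.b i := by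
  refine Z.ext' fun k => ?_; simp; grind
@[simp] lemma E_mul_c : Z.E i * Z.c i = Z.c i := by
  refine Z.ext' fun k => ?_; simp; grind
lemma a_mul_a : Z.a i * Z.a j = 0 := by
  refine Z.ext' fun k => ?_; simp
lemma b_mul_b : Z.b i * Z.b j = 0 := by
  refine Z.ext' fun k => ?_; simp
lemma a_mul_b : Z.a i * Z.b i = Z.c i := by
  refine Z.ext' fun k => ?_; simp; grind
/-- At `i + 2 = n` the right-hand side is zero. -/
lemma b_mul_a : Z.b i * Z.a i = Z.c (i + 1) := by
  refine Z.ext' fun k => ?_; simp; grind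

lemma E_eq_zero (h : n ≤ i) : Z.E i = 0 := by
  refine Z.ext' fun k => ?_; simp; omega
lemma a_eq_zero (h : n ≤ i + 1) : Z.a i = 0 := by
  refine Z.ext' fun k => ?_; simp; omega
lemma b_eq_zero (h : n ≤ i + 1) : Z.b i = 0 := by
  refine Z.ext' fun k => ?_; simp; omega

lemma sum_E : ∑ i ∈ Finset.range n, Z.E i = 1 := by
  refine Z.ext (fun k hk => ?_) (fun k hk => ?_) (fun k hk => ?_) (fun k hk => ?_)
  · rw [map_sum, Finset.sum_eq_single k] <;> simp +contextual [Z.ε_one, hk, eq_comm]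
  all_goals simp

end ZigzagCoordinates

/-! ### Coordinates of the quiver algebra -/

namespace QuiverAlgebraB

variable (K : Type u) [Field K] (n : ℕ)

/-- The trivial path at a vertex, `0` for `n ≤ i`. -/
noncomputable def E (i : ℕ) : QuiverAlgebraB K n (fun _ => 1) :=
  if h : i < n then RingQuot.mkAlgHom K _ (BFree.vertex K ⟨i, h⟩) else 0

/-- The arrow `i ⟶ i + 1`, `0` for `n ≤ i + 1`. -/
noncomputable def a (i : ℕ) : QuiverAlgebraB K n (fun _ => 1) :=
  if h : i < n - 1 then RingQuot.mkAlgHom K _ (BFree.arrow K (.a ⟨i, h⟩)) else 0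

/-- The arrow `i + 1 ⟶ i`, `0` for `n ≤ i + 1`. -/
noncomputable def b (i : ℕ) : QuiverAlgebraB K n (fun _ => 1) :=
  if h : i < n - 1 then RingQuot.mkAlgHom K _ (BFree.arrow K (.b ⟨i, h⟩)) else 0

variable {K n}

lemma mk_eq {x y : BFree K n} (h : BRel K n (fun _ => 1) x y) :
    RingQuot.mkAlgHom K (BRel K n (fun _ => 1)) x = RingQuot.mkAlgHom K _ y :=
  RingQuot.mkAlgHom_rel K h

lemma E_mul_E (i j : ℕ) : E K n i * E K n j = if i = j then E K n i else 0 := by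
  unfold E
  by_cases hi : i < n <;> by_cases hj : j < n <;> simp only [hi, hj, dite_true, dite_false]
  · rw [← map_mul]
    split_ifs with h
    · subst h
      exact mk_eq (.vertex_idem _)
    · rw [mk_eq (.vertex_orth _ _ (by simpa using h)), map_zero]
  · rw [mul_zero, if_neg (by omega)]
  all_goals simp

lemma E_mul_a (i : ℕ) : E K n i * a K n i = a K n i := by
  unfold E a
  by_cases hi : i < n - 1
  · simp only [hi, show i < n by omega, dite_true, ← map_mul]
    exact mk_eq (.source_mul (.a ⟨i, hi⟩))
  · simp [hi]

lemma a_mul_E (i : ℕ) : a K n i * E K n (i + 1) = a K n i := by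
  unfold E a
  by_cases hi : i < n - 1
  · simp only [hi, show i + 1 < n by omega, dite_true, ← map_mul]
    exact mk_eq (.mul_target (.a ⟨i, hi⟩))
  · simp [hi]

lemma E_mul_b (i : ℕ) : E K n (i + 1) * b K n i = b K n i := by
  unfold E b
  by_cases hi : i < n - 1
  · simp only [hi, show i + 1 < n by omega, dite_true, ← map_mul]
    exact mk_eq (.source_mul (.b ⟨i, hi⟩))
  · simp [hi]

lemma b_mul_E (i : ℕ) : b K n i * E K n i = b K n i := by
  unfold E b
  by_cases hi : i < n - 1
  · simp only [hi, show i < n by omega, dite_true, ← map_mul]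
    exact mk_eq (.mul_target (.b ⟨i, hi⟩))
  · simp [hi]

lemma a_mul_a_succ (i : ℕ) : a K n i * a K n (i + 1) = 0 := by
  unfold a
  by_cases hi : i + 1 < n - 1
  · simp only [hi, show i < n - 1 by omega, dite_true, ← map_mul]
    rw [mk_eq (.a_mul_a ⟨i, by omega⟩), map_zero]
  · simp [hi]

lemma b_succ_mul_b (i : ℕ) : b K n (i + 1) * b K n i = 0 := by
  unfold b
  by_cases hi : i + 1 < n - 1
  · simp only [hi, show i < n - 1 by omega, dite_true, ← map_mul]
    rw [mk_eq (.b_mul_b ⟨i, by omega⟩), map_zero]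
  · simp [hi]

/-- The relation at an inner vertex and the one at the last vertex, where `a` and `b` on the right
are zero. -/
lemma b_mul_a_self (i : ℕ) : b K n i * a K n i = a K n (i + 1) * b K n (i + 1) := by
  unfold a b
  by_cases hi : i + 1 < n - 1
  · simp only [hi, show i < n - 1 by omega, dite_true, ← map_mul]
    rw [mk_eq (.middle ⟨i, by omega⟩), one_smul]
  · by_cases h : i < n - 1
    · simp only [hi, h, dite_true, dite_false, ← map_mul, mul_zero]
      rw [mk_eq (.last ⟨i, h⟩ (show i + 2 = n by omega)), map_zero]
    · simp [hi, h]

lemma a_mul_E' (i j : ℕ) : a K n i * E K n j = if j = i + 1 then a K n i else 0 := by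
  rw [← a_mul_E, mul_assoc, E_mul_E]
  grind

lemma b_mul_E' (i j : ℕ) : b K n i * E K n j = if j = i then b K n i else 0 := by
  rw [← b_mul_E, mul_assoc, E_mul_E]
  grind

lemma a_mul_a (i j : ℕ) : a K n i * a K n j = 0 := by
  rw [← E_mul_a j, ← mul_assoc, a_mul_E']
  split_ifs with h
  · rw [h, a_mul_a_succ]
  · simp

lemma b_mul_b (i j : ℕ) : b K n i * b K n j = 0 := by
  rw [← E_mul_b j, ← mul_assoc, b_mul_E']
  split_ifs with h
  · rw [← h, b_succ_mul_b]
  · simp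

lemma a_mul_b (i j : ℕ) : a K n i * b K n j = if j = i then a K n i * b K n i else 0 := by
  rw [← E_mul_b j, ← mul_assoc, a_mul_E']
  grind

lemma b_mul_a (i j : ℕ) : b K n i * a K n j =
    if j = i then a K n (i + 1) * b K n (i + 1) else 0 := by
  rw [← E_mul_a j, ← mul_assoc, b_mul_E', ← b_mul_a_self]
  grind

lemma a_mul_c (i j : ℕ) : a K n i * (a K n j * b K n j) = 0 := by
  rw [← mul_assoc, a_mul_a, zero_mul]

lemma b_mul_c (i j : ℕ) : b K n i * (a K n j * b K n j) = 0 := by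
  rw [← mul_assoc, b_mul_a]
  split_ifs
  · rw [mul_assoc, b_mul_b, mul_zero]
  · simp

variable (K n) in
/-- The span of the paths of length at most two. -/
noncomputable def pathSpan : Submodule K (QuiverAlgebraB K n (fun _ => 1)) :=
  Submodule.span K (Set.range (E K n) ∪ Set.range (a K n) ∪ Set.range (b K n) ∪
    Set.range fun i => a K n i * b K n i)

lemma E_mem (i : ℕ) : E K n i ∈ pathSpan K n := Submodule.subset_span (by simp)
lemma a_mem (i : ℕ) : a K n i ∈ pathSpan K n := Submodule.subset_span (by simp)
lemma b_mem (i : ℕ) : b K n i ∈ pathSpan K n := Submodule.subset_span (by simp)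
lemma c_mem (i : ℕ) : a K n i * b K n i ∈ pathSpan K n := Submodule.subset_span (by simp)

/-- It suffices to multiply the spanning paths from the left. -/
lemma mul_mem_pathSpan {g : QuiverAlgebraB K n (fun _ => 1)}
    (hE : ∀ i, g * E K n i ∈ pathSpan K n) (ha : ∀ i, g * a K n i ∈ pathSpan K n)
    (hb : ∀ i, g * b K n i ∈ pathSpan K n) (hc : ∀ i, g * (a K n i * b K n i) ∈ pathSpan K n)
    {x : QuiverAlgebraB K n (fun _ => 1)} (hx : x ∈ pathSpan K n) : g * x ∈ pathSpan K n := by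
  induction hx using Submodule.span_induction with
  | mem x hx => rcases hx with ((⟨i, rfl⟩ | ⟨i, rfl⟩) | ⟨i, rfl⟩) | ⟨i, rfl⟩ <;> simp only [*]
  | zero => simp
  | add x y _ _ hx hy => rw [mul_add]; exact add_mem hx hy
  | smul r x _ hx => rw [mul_smul_comm]; exact Submodule.smul_mem _ _ hx

lemma E_mul_mem (i : ℕ) {x : QuiverAlgebraB K n (fun _ => 1)} (hx : x ∈ pathSpan K n) :
    E K n i * x ∈ pathSpan K n := by
  have key (j : ℕ) (y : QuiverAlgebraB K n (fun _ => 1)) (hy : E K n j * y ∈ pathSpan K n) :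
      E K n i * (E K n j * y) ∈ pathSpan K n := by
    rw [← mul_assoc, E_mul_E]
    split_ifs with h
    · rwa [h]
    · simp
  refine mul_mem_pathSpan (fun j => ?_) (fun j => ?_) (fun j => ?_) (fun j => ?_) hx
  · rw [E_mul_E]
    split_ifs
    exacts [E_mem _, zero_mem _]
  · rw [← E_mul_a]
    exact key _ _ (by rw [E_mul_a]; exact a_mem _)
  · rw [← E_mul_b]
    exact key _ _ (by rw [E_mul_b]; exact b_mem _)
  · rw [← E_mul_a, mul_assoc (E K n j)]
    exact key _ _ (by rw [← mul_assoc, E_mul_a]; exact c_mem _)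

lemma a_mul_mem (i : ℕ) {x : QuiverAlgebraB K n (fun _ => 1)} (hx : x ∈ pathSpan K n) :
    a K n i * x ∈ pathSpan K n := by
  refine mul_mem_pathSpan (fun j => ?_) (fun j => ?_) (fun j => ?_) (fun j => ?_) hx
  · rw [a_mul_E']
    split_ifs
    exacts [a_mem _, zero_mem _]
  · simp [a_mul_a]
  · rw [a_mul_b]
    split_ifs
    exacts [c_mem _, zero_mem _]
  · simp [a_mul_c]

lemma b_mul_mem (i : ℕ) {x : QuiverAlgebraB K n (fun _ => 1)} (hx : x ∈ pathSpan K n) :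
    b K n i * x ∈ pathSpan K n := by
  refine mul_mem_pathSpan (fun j => ?_) (fun j => ?_) (fun j => ?_) (fun j => ?_) hx
  · rw [b_mul_E']
    split_ifs
    exacts [b_mem _, zero_mem _]
  · rw [b_mul_a]
    split_ifs
    exacts [c_mem _, zero_mem _]
  · simp [b_mul_b]
  · simp [b_mul_c]

lemma one_mem_pathSpan : (1 : QuiverAlgebraB K n (fun _ => 1)) ∈ pathSpan K n := by
  rw [← map_one (RingQuot.mkAlgHom K (BRel K n (fun _ => 1))),
    ← mk_eq .vertex_sum, map_sum]
  refine sum_mem fun i _ => ?_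
  have := E_mem (K := K) (n := n) i
  rwa [E, dif_pos i.2] at this

/-- The span of the short paths is stable under left multiplication by the generators and contains
`1`. -/
lemma pathSpan_eq_top : pathSpan K n = ⊤ := by
  have key (z : BFree K n) : ∀ x ∈ pathSpan K n,
      RingQuot.mkAlgHom K (BRel K n (fun _ => 1)) z * x ∈ pathSpan K n := by
    induction z using FreeAlgebra.induction with
    | grade0 r =>
      intro x hx
      rw [AlgHom.commutes, ← Algebra.smul_def]
      exact Submodule.smul_mem _ _ hx
    | grade1 g =>
      intro x hx
      rcases g with i | ⟨i | i⟩
      · have := E_mul_mem i hx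
        rwa [E, dif_pos i.2] at this
      · have := a_mul_mem i hx
        rwa [a, dif_pos i.2] at this
      · have := b_mul_mem i hx
        rwa [b, dif_pos i.2] at this
    | mul z w hz hw =>
      intro x hx
      rw [map_mul, mul_assoc]
      exact hz _ (hw _ hx)
    | add z w hz hw =>
      intro x hx
      rw [map_add, add_mul]
      exact add_mem (hz _ hx) (hw _ hx)
  rw [eq_top_iff]
  rintro x -
  obtain ⟨z, rfl⟩ := RingQuot.mkAlgHom_surjective K _ x
  simpa using key z 1 one_mem_pathSpan

variable (K n)

/-- The tautological coordinates of the model. -/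
abbrev modelCoordinates : ZigzagCoordinates K n (ZigzagModel K n) := AlgEquiv.refl

/-- The elements of the model to which the vertices and arrows are sent. -/
def toModelGen : Fin n ⊕ BArrow n → ZigzagModel K n
  | .inl i => (modelCoordinates K n).E i
  | .inr (.a i) => (modelCoordinates K n).a i
  | .inr (.b i) => (modelCoordinates K n).b i

/-- The algebra homomorphism from the quiver algebra to the model: the relations hold there. -/
noncomputable def toModel : QuiverAlgebraB K n (fun _ => 1) →ₐ[K] ZigzagModel K n :=
  RingQuot.liftAlgHom K ⟨FreeAlgebra.lift K (toModelGen K n), by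
    intro x y h
    induction h with
    | vertex_idem i => simp [BFree.vertex, toModelGen]
    | vertex_orth i j h =>
      simp [BFree.vertex, toModelGen, ZigzagCoordinates.E_mul_E, Fin.val_inj, h]
    | vertex_sum =>
      simp only [BFree.vertex, map_sum, FreeAlgebra.lift_ι_apply, toModelGen, map_one]
      rw [Fin.sum_univ_eq_sum_range (fun i => (modelCoordinates K n).E i) n,
        ZigzagCoordinates.sum_E]
    | source_mul x => cases x <;> simp [BFree.vertex, BFree.arrow, BArrow.source, toModelGen]
    | mul_target x => cases x <;> simp [BFree.vertex, BFree.arrow, BArrow.target, toModelGen]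
    | last i h =>
      simp only [BFree.arrow, map_mul, FreeAlgebra.lift_ι_apply, toModelGen, map_zero,
        ZigzagCoordinates.b_mul_a]
      rw [← ZigzagCoordinates.a_mul_b, ZigzagCoordinates.a_eq_zero _ _ (by omega), zero_mul]
    | middle k =>
      simp [BFree.arrow, toModelGen, ZigzagCoordinates.b_mul_a, ZigzagCoordinates.a_mul_b]
    | a_mul_a k => simp [BFree.arrow, toModelGen, ZigzagCoordinates.a_mul_a]
    | b_mul_b k => simp [BFree.arrow, toModelGen, ZigzagCoordinates.b_mul_b]⟩

lemma toModel_E (i : ℕ) : toModel K n (E K n i) = (modelCoordinates K n).E i := by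
  unfold E
  split_ifs with h
  · simp [toModel, BFree.vertex, toModelGen]
  · rw [map_zero, ZigzagCoordinates.E_eq_zero _ _ (by omega)]

lemma toModel_a (i : ℕ) : toModel K n (a K n i) = (modelCoordinates K n).a i := by
  unfold a
  split_ifs with h
  · simp [toModel, BFree.arrow, toModelGen]
  · rw [map_zero, ZigzagCoordinates.a_eq_zero _ _ (by omega)]

lemma toModel_b (i : ℕ) : toModel K n (b K n i) = (modelCoordinates K n).b i := by
  unfold b
  split_ifs with h
  · simp [toModel, BFree.arrow, toModelGen]
  · rw [map_zero, ZigzagCoordinates.b_eq_zero _ _ (by omega)]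

/-- The linear map that sends the basis of the model to the paths. -/
noncomputable def ofModel : ZigzagModel K n →ₗ[K] QuiverAlgebraB K n (fun _ => 1) :=
  ∑ i ∈ Finset.range n,
    (((modelCoordinates K n).ε i).smulRight (E K n i) +
      ((modelCoordinates K n).α i).smulRight (a K n i) +
      ((modelCoordinates K n).β i).smulRight (b K n i) +
      ((modelCoordinates K n).γ i).smulRight (a K n i * b K n i))

lemma ofModel_toModel (x : QuiverAlgebraB K n (fun _ => 1)) :
    ofModel K n (toModel K n x) = x := by
  have hE (i : ℕ) (h : n ≤ i) : E K n i = 0 := dif_neg (by omega)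
  have ha (i : ℕ) (h : n ≤ i + 1) : a K n i = 0 := dif_neg (by omega)
  have hb (i : ℕ) (h : n ≤ i + 1) : b K n i = 0 := dif_neg (by omega)
  have h : Set.EqOn (ofModel K n ∘ₗ (toModel K n).toLinearMap)
      (LinearMap.id (R := K) (M := QuiverAlgebraB K n (fun _ => 1)))
      (pathSpan K n : Set (QuiverAlgebraB K n (fun _ => 1))) := by
    refine LinearMap.eqOn_span' ?_
    rintro x (((⟨i, rfl⟩ | ⟨i, rfl⟩) | ⟨i, rfl⟩) | ⟨i, rfl⟩) <;>
      simp only [LinearMap.comp_apply, AlgHom.toLinearMap_apply, map_mul, toModel_E, toModel_a,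
        toModel_b, ZigzagCoordinates.a_mul_b, ofModel, LinearMap.sum_apply, LinearMap.add_apply,
        LinearMap.smulRight_apply, LinearMap.id_apply] <;>
      rw [Finset.sum_eq_single i]
    all_goals first
      | exact fun j _ hj => by simp [hj]
      | simp +contextual
    · exact fun h => (hE i h).symm
    · exact fun h => (ha i h).symm
    · exact fun h h' => by omega
    · exact fun h => (hb i h).symm
    · exact fun h h' => by omega
    · exact fun h => by rw [ha i h, zero_mul]
    · exact fun h h' => by omega
  exact h (by simp [pathSpan_eq_top])

/-- The coordinates of the quiver algebra. -/
noncomputable def coordinates : ZigzagCoordinates K n (QuiverAlgebraB K n (fun _ => 1)) :=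
  AlgEquiv.ofBijective (toModel K n) ⟨(Function.LeftInverse.injective (ofModel_toModel K n)), by
    intro v
    refine ⟨ofModel K n v, ?_⟩
    refine (modelCoordinates K n).ext (fun k hk => ?_) (fun k hk => ?_) (fun k hk => ?_)
        (fun k hk => ?_) <;>
      simp only [ofModel, LinearMap.sum_apply, map_sum, LinearMap.add_apply,
        LinearMap.smulRight_apply, map_add, map_smul, map_mul, toModel_E, toModel_a, toModel_b,
        ZigzagCoordinates.a_mul_b] <;>
      rw [Finset.sum_eq_single k]
    all_goals first
      | exact fun h => absurd (Finset.mem_range.2 (by omega)) h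
      | exact fun i _ hi => by simp [hi.symm]
      | simp [hk]⟩

end QuiverAlgebraB

/-! ### Minimal injective resolutions and duals of left modules -/

section MinimalResolutions

variable {R : Type u} [Ring R]

/-- A map that is injective on an essential submodule is injective. -/
lemma IsEssentialSubmodule.ker_eq_bot {I I' : Type u} [AddCommGroup I] [Module R I]
    [AddCommGroup I'] [Module R I'] {N : Submodule R I} (hN : IsEssentialSubmodule N)
    {f : I →ₗ[R] I'} (hf : ∀ x ∈ N, f x = 0 → x = 0) : LinearMap.ker f = ⊥ := by
  by_contra h
  exact hN _ h (eq_bot_iff.2 fun x hx => hf x hx.1 hx.2)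

lemma Module.Injective.prod (I I' : Type u) [AddCommGroup I] [Module R I]
    [AddCommGroup I'] [Module R I'] [hI : Module.Injective R I] [hI' : Module.Injective R I'] :
    Module.Injective R (I × I') where
  out X Y _ _ _ _ i hi g := by
    obtain ⟨h, hh⟩ := hI.out i hi (LinearMap.fst R I I' ∘ₗ g)
    obtain ⟨h', hh'⟩ := hI'.out i hi (LinearMap.snd R I I' ∘ₗ g)
    exact ⟨h.prod h', fun x => Prod.ext (hh x) (hh' x)⟩

/-- Uniqueness of injective envelopes: an isomorphism of essential submodules extends. -/
lemma exists_equiv_of_essential {I I' : Type u} [AddCommGroup I] [Module R I]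
    [AddCommGroup I'] [Module R I'] [hI : Module.Injective R I] [hI' : Module.Injective R I']
    {N : Submodule R I} {N' : Submodule R I'} (hN : IsEssentialSubmodule N)
    (hN' : IsEssentialSubmodule N') (e : N ≃ₗ[R] N') :
    ∃ φ : I ≃ₗ[R] I', N.map φ.toLinearMap = N' := by
  obtain ⟨F, hF⟩ := hI'.out N.subtype N.injective_subtype (N'.subtype ∘ₗ e.toLinearMap)
  have hF' (x : I) (hx : x ∈ N) : F x = e ⟨x, hx⟩ := hF ⟨x, hx⟩
  have injF : Function.Injective F := LinearMap.ker_eq_bot.1 (hN.ker_eq_bot fun x hx h => by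
    rw [hF' x hx] at h
    simpa using h)
  -- The retraction `G` of `F` is injective on `N'`, hence injective, which makes `F` surjective.
  obtain ⟨G, hG⟩ := hI.out F injF LinearMap.id
  have hFN (y : I') (hy : y ∈ N') : ∃ x ∈ N, F x = y :=
    ⟨e.symm ⟨y, hy⟩, Subtype.prop _, by rw [hF' _ (Subtype.prop _)]; simp⟩
  have injG : Function.Injective G := LinearMap.ker_eq_bot.1 (hN'.ker_eq_bot fun y hy h => by
    obtain ⟨x, -, rfl⟩ := hFN y hy
    rw [hG] at h
    rw [show x = 0 from h, map_zero])
  refine ⟨LinearEquiv.ofBijective F ⟨injF, fun y => ⟨G y, injG (hG _)⟩⟩, ?_⟩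
  ext y
  constructor
  · rintro ⟨x, hx, rfl⟩
    exact (hF' x hx).symm ▸ Subtype.prop _
  · intro hy
    obtain ⟨x, hx, rfl⟩ := hFN y hy
    exact ⟨x, hx, rfl⟩

/-- Minimal injective resolutions of a module are unique, degree by degree. That the isomorphism
matches the kernels makes the induction work: the image in the next degree is the quotient by the
kernel. -/
lemma MinimalInjectiveResolution.exists_equiv {M : Type u} [AddCommGroup M] [Module R M]
    (P Q : MinimalInjectiveResolution R M) (i : ℕ) :
    ∃ φ : P.I i ≃ₗ[R] Q.I i,
      (LinearMap.ker (P.d i)).map φ.toLinearMap = LinearMap.ker (Q.d i) := by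
  induction i with
  | zero =>
    have := P.injective 0
    have := Q.injective 0
    rw [P.exact_zero.linearMap_ker_eq, Q.exact_zero.linearMap_ker_eq]
    exact exists_equiv_of_essential P.essential_zero Q.essential_zero
      ((LinearEquiv.ofInjective P.ι P.ι_injective).symm.trans
        (LinearEquiv.ofInjective Q.ι Q.ι_injective))
  | succ i ih =>
    obtain ⟨φ, hφ⟩ := ih
    have := P.injective (i + 1)
    have := Q.injective (i + 1)
    rw [(P.exact_succ i).linearMap_ker_eq, (Q.exact_succ i).linearMap_ker_eq]
    exact exists_equiv_of_essential (P.essential_succ i) (Q.essential_succ i)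
      ((P.d i).quotKerEquivRange.symm.trans
        ((Submodule.Quotient.equiv _ _ φ hφ).trans (Q.d i).quotKerEquivRange))

/-- A single minimal injective resolution determines the dominant dimension. -/
lemma MinimalInjectiveResolution.moduleDominantDimension_eq {M : Type u} [AddCommGroup M]
    [Module R M] (P : MinimalInjectiveResolution R M) (k : ℕ)
    (hk : ∀ i < k, Module.Projective R (P.I i)) (hk' : ¬ Module.Projective R (P.I k)) :
    moduleDominantDimension R M = k := by
  apply le_antisymm
  · refine iSup_le fun Q => iSup₂_le fun l hl => ?_
    by_contra! h
    obtain ⟨φ, -⟩ := Q.exists_equiv P k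
    have := hl k (by exact_mod_cast h)
    exact hk' (Module.Projective.of_equiv φ)
  · exact le_iSup_of_le P (le_iSup₂_of_le k hk le_rfl)

end MinimalResolutions

section Coregular

variable (K : Type u) [Field K] (A : Type u) [Ring A] [Algebra K A]

/-- The dual of `A`, as a right module: `φ * x` is the functional `y ↦ φ (x * y)`. A type synonym,
so that no other action on functionals interferes. -/
def CoregularModule : Type u := Module.Dual K A

namespace CoregularModule

instance : AddCommGroup (CoregularModule K A) := inferInstanceAs (AddCommGroup (Module.Dual K A))

instance : FunLike (CoregularModule K A) A K := inferInstanceAs (FunLike (Module.Dual K A) A K)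

instance : LinearMapClass (CoregularModule K A) K A K :=
  inferInstanceAs (LinearMapClass (Module.Dual K A) K A K)

variable {K A}

@[ext] lemma ext {φ ψ : CoregularModule K A} (h : ∀ x, φ x = ψ x) : φ = ψ := LinearMap.ext h

@[simp] lemma add_apply (φ ψ : CoregularModule K A) (x : A) : (φ + ψ) x = φ x + ψ x := rfl
@[simp] lemma zero_apply (x : A) : (0 : CoregularModule K A) x = 0 := rfl

instance : Module Aᵐᵒᵖ (CoregularModule K A) where
  smul x φ := LinearMap.comp (show A →ₗ[K] K from φ) (LinearMap.mulLeft K x.unop)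
  one_smul φ := ext fun _ => congrArg φ (one_mul _)
  mul_smul _ _ φ := ext fun _ => congrArg φ (mul_assoc _ _ _)
  smul_zero _ := rfl
  smul_add _ _ _ := rfl
  add_smul _ _ φ := ext fun _ => (congrArg φ (add_mul _ _ _)).trans (map_add φ _ _)
  zero_smul φ := ext fun _ => (congrArg φ (zero_mul _)).trans (map_zero φ)

@[simp] lemma smul_apply (x : Aᵐᵒᵖ) (φ : CoregularModule K A) (y : A) :
    (x • φ) y = φ (x.unop * y) := rfl

variable (K) in
/-- The dual of the left module `A e`, for an idempotent `e`: as `A = A e ⊕ A (1 - e)`, it consists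
of the functionals `φ` on `A` with `φ (y * e) = φ y`. -/
def dualOf (e : A) : Submodule Aᵐᵒᵖ (CoregularModule K A) where
  carrier := {φ | ∀ y, φ (y * e) = φ y}
  add_mem' hφ hψ y := by simp [hφ y, hψ y]
  zero_mem' y := rfl
  smul_mem' x φ hφ y := by simp only [smul_apply, ← mul_assoc]; exact hφ _

/-- Homomorphisms `X → dualOf K e` correspond to the functionals `x ↦ g x 1` on `X` that vanish on
`X (1 - e)`, and functionals on a subspace extend. -/
lemma dualOf_injective {e : A} (he : e * e = e) : Module.Injective Aᵐᵒᵖ (dualOf K e) where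
  out X Y _ _ _ _ f hf g := by
    let _ : Module K X := Module.restrictScalars K Aᵐᵒᵖ X
    let _ : Module K Y := Module.restrictScalars K Aᵐᵒᵖ Y
    have : IsScalarTower K Aᵐᵒᵖ X := IsScalarTower.restrictScalars K Aᵐᵒᵖ X
    have : IsScalarTower K Aᵐᵒᵖ Y := IsScalarTower.restrictScalars K Aᵐᵒᵖ Y
    obtain ⟨s, hs⟩ := (f.restrictScalars K).exists_leftInverse_of_injective
      (LinearMap.ker_eq_bot.2 hf)
    have hs (x : X) : s (f x) = x := LinearMap.congr_fun hs x
    have hsmul (r : K) (x : X) : (g (r • x) : CoregularModule K A) 1 =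
        r * (g x : CoregularModule K A) 1 := by
      rw [algebra_compatible_smul Aᵐᵒᵖ r x, map_smul]
      change (g x : CoregularModule K A) (algebraMap K A r * 1) = _
      rw [← Algebra.smul_def, map_smul, smul_eq_mul]
    let μ : Y →ₗ[K] K :=
      { toFun y := (g (s y) : CoregularModule K A) 1
        map_add' y y' := by simp
        map_smul' r y := by simp [hsmul] }
    let h (y : Y) : dualOf K e := ⟨show A →ₗ[K] K from
      { toFun z := μ (MulOpposite.op (z * e) • y)
        map_add' z z' := by simp [add_mul, add_smul]
        map_smul' r z := by
          rw [smul_mul_assoc, MulOpposite.op_smul, smul_assoc, map_smul, RingHom.id_apply] },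
      fun z => by
        change μ (MulOpposite.op (z * e * e) • y) = μ (MulOpposite.op (z * e) • y)
        rw [mul_assoc, he]⟩
    refine ⟨{ toFun := h, map_add' := ?_, map_smul' := ?_}, ?_⟩
    · intro y y'
      refine Subtype.ext (ext fun z => ?_)
      change μ (MulOpposite.op (z * e) • (y + y')) = _
      rw [smul_add, map_add]
      rfl
    · intro x y
      refine Subtype.ext (ext fun z => ?_)
      change μ (MulOpposite.op (z * e) • x • y) = μ (MulOpposite.op (x.unop * z * e) • y)
      rw [smul_smul, mul_assoc, MulOpposite.op_mul x.unop, MulOpposite.op_unop]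
    · intro x
      refine Subtype.ext (ext fun z => ?_)
      change (g (s (MulOpposite.op (z * e) • f x)) : CoregularModule K A) 1 = _
      rw [← map_smul, hs, map_smul]
      change (g x : CoregularModule K A) (z * e * 1) = _
      rw [mul_one]
      exact (g x).2 z

/-- The dual of the right multiplication by `g` from `A e'` to `A e`. Membership of `g` in `A e` is
not needed, since the functionals in `dualOf K e` ignore `A (1 - e)`. -/
def dualMap {e e' : A} (g : A) (h : e' * g = g) : dualOf K e →ₗ[Aᵐᵒᵖ] dualOf K e' where
  toFun φ := ⟨LinearMap.comp (show A →ₗ[K] K from φ.1) (LinearMap.mulRight K g), fun y => by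
    change φ.1 (y * e' * g) = φ.1 (y * g)
    rw [mul_assoc, h]⟩
  map_add' φ ψ := rfl
  map_smul' x φ := Subtype.ext (ext fun y => congrArg φ.1 (mul_assoc x.unop y g).symm)

@[simp] lemma dualMap_apply {e e' : A} (g : A) (h : e' * g = g) (φ : dualOf K e) (y : A) :
    (dualMap g h φ : CoregularModule K A) y = φ.1 (y * g) := rfl

end CoregularModule

end Coregular

/-! ### Radical, socle and the indecomposable injective modules -/

/-- The homomorphism `x ↦ w * x` from the right regular module to `M`, for `w : M`. -/
def orbitMap {A M : Type u} [Ring A] [AddCommGroup M] [Module Aᵐᵒᵖ M] (w : M) : A →ₗ[Aᵐᵒᵖ] M where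
  toFun x := MulOpposite.op x • w
  map_add' x y := by simp [add_smul]
  map_smul' r x := by
    rw [RingHom.id_apply, smul_smul]
    rfl

@[simp] lemma orbitMap_apply {A M : Type u} [Ring A] [AddCommGroup M] [Module Aᵐᵒᵖ M] (w : M)
    (x : A) : orbitMap w x = MulOpposite.op x • w := rfl

namespace ZigzagCoordinates

variable {K : Type u} [Field K] {n : ℕ} {A : Type u} [Ring A] [Algebra K A]
  (Z : ZigzagCoordinates K n A)

lemma sum_basis (x : A) : ∑ i ∈ Finset.range n, (Z.ε i x • Z.E i + Z.α i x • Z.a i +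
    Z.β i x • Z.b i + Z.γ i x • Z.c i) = x := by
  refine Z.ext (fun k hk => ?_) (fun k hk => ?_) (fun k hk => ?_) (fun k hk => ?_) <;>
    rw [map_sum, Finset.sum_eq_single k]
  all_goals first
    | exact fun h => absurd (Finset.mem_range.2 (by omega)) h
    | exact fun i _ hi => by simp [hi.symm]
    | simp [hk]

/-- Linear maps that agree on the basis are equal. -/
lemma dual_ext {V : Type*} [AddCommGroup V] [Module K V] {φ ψ : A →ₗ[K] V}
    (hE : ∀ i < n, φ (Z.E i) = ψ (Z.E i))
    (ha : ∀ i, i + 1 < n → φ (Z.a i) = ψ (Z.a i)) (hb : ∀ i, i + 1 < n → φ (Z.b i) = ψ (Z.b i))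
    (hc : ∀ i, i + 1 < n → φ (Z.c i) = ψ (Z.c i)) (x : A) : φ x = ψ x := by
  rw [← Z.sum_basis x, map_sum, map_sum]
  refine Finset.sum_congr rfl fun i hi => ?_
  have hi := Finset.mem_range.1 hi
  by_cases h : i + 1 < n
  · simp only [map_add, map_smul, hE i hi, ha i h, hb i h, hc i h]
  · simp only [map_add, map_smul, hE i hi, Z.α_eq_zero i x (by omega), Z.β_eq_zero i x (by omega),
      Z.γ_eq_zero i x (by omega), zero_smul, map_zero]

lemma finiteDimensional {K : Type u} [Field K] {n : ℕ} {A : Type u} [Ring A] [Algebra K A]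
    (Z : ZigzagCoordinates K n A) : FiniteDimensional K A := by
  have h : Submodule.span K (Set.range fun p : Fin n × Fin 4 =>
      ![Z.E p.1, Z.a p.1, Z.b p.1, Z.c p.1] p.2) = ⊤ := by
    rw [eq_top_iff]
    rintro x -
    rw [← Z.sum_basis x]
    refine sum_mem fun i hi => ?_
    have hi := Finset.mem_range.1 hi
    refine add_mem (add_mem (add_mem ?_ ?_) ?_) ?_ <;> refine Submodule.smul_mem _ _
      (Submodule.subset_span ?_)
    exacts [⟨(⟨i, hi⟩, 0), rfl⟩, ⟨(⟨i, hi⟩, 1), rfl⟩, ⟨(⟨i, hi⟩, 2), rfl⟩, ⟨(⟨i, hi⟩, 3), rfl⟩]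
  exact Module.finite_def.2 (h ▸ Submodule.fg_span (Set.finite_range _))

/-- No trivial path occurs in `x`. These elements form the Jacobson radical, see
`mem_jacobson_iff`. -/
def IsRad (x : A) : Prop := ∀ i, Z.ε i x = 0

variable {Z}

lemma IsRad.mul_left {x : A} (hx : Z.IsRad x) (y : A) : Z.IsRad (y * x) := fun i => by
  rw [ε_mul, hx i, mul_zero]

lemma IsRad.mul_right {x : A} (hx : Z.IsRad x) (y : A) : Z.IsRad (x * y) := fun i => by
  rw [ε_mul, hx i, zero_mul]

/-- The cube of the radical is zero. -/
lemma IsRad.mul_mul_eq_zero {x y z : A} (hx : Z.IsRad x) (hy : Z.IsRad y) (hz : Z.IsRad z) :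
    x * y * z = 0 := by
  refine Z.ext' fun i => ?_
  cases i <;> simp [ε_mul, α_mul, β_mul, γ_mul_zero, γ_mul_succ, hx _, hy _, hz _]

variable (Z)

/-- A submodule that contains the socle, that is, all elements annihilated by the radical, is
essential. -/
lemma essential_of_socle_le {M : Type u} [AddCommGroup M] [Module Aᵐᵒᵖ M] {N : Submodule Aᵐᵒᵖ M}
    (hN : ∀ m : M, (∀ x, Z.IsRad x → MulOpposite.op x • m = 0) → m ∈ N) :
    IsEssentialSubmodule N := by
  intro L hL h
  obtain ⟨m, hm, hm0⟩ := L.ne_bot_iff.1 hL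
  have key (m' : M) (hm' : m' ∈ L) (h0 : m' ≠ 0) :
      ∃ x, Z.IsRad x ∧ MulOpposite.op x • m' ≠ 0 := by
    by_contra! hc
    exact h0 ((Submodule.mem_bot _).1 (h ▸ Submodule.mem_inf.2 ⟨hN m' hc, hm'⟩))
  -- Otherwise a nonzero element of `L` stays nonzero after acting with three radical elements.
  obtain ⟨x, hx, hxm⟩ := key m hm hm0
  obtain ⟨y, hy, hym⟩ := key _ (L.smul_mem _ hm) hxm
  obtain ⟨z, hz, hzm⟩ := key _ (L.smul_mem _ (L.smul_mem _ hm)) hym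
  apply hzm
  rw [smul_smul, smul_smul, ← MulOpposite.op_mul, ← MulOpposite.op_mul, ← mul_assoc,
    hx.mul_mul_eq_zero hy hz, MulOpposite.op_zero, zero_smul]

open CoregularModule

/-- The dual of the left module `A E i`: the indecomposable injective right module whose socle is
the simple module at the vertex `i`. It is zero for `n ≤ i`. -/
abbrev T (i : ℕ) : Submodule Aᵐᵒᵖ (CoregularModule K A) := dualOf K (Z.E i)

lemma mul_E_zero (y : A) : y * Z.E 0 = Z.ε 0 y • Z.E 0 + Z.β 0 y • Z.b 0 + Z.γ 0 y • Z.c 0 := by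
  refine Z.ext (fun k hk => ?_) (fun k hk => ?_) (fun k hk => ?_) (fun k hk => ?_) <;>
    simp <;> grind

lemma mul_E_succ (i : ℕ) (y : A) : y * Z.E (i + 1) = Z.ε (i + 1) y • Z.E (i + 1) +
    Z.α i y • Z.a i + Z.β (i + 1) y • Z.b (i + 1) + Z.γ (i + 1) y • Z.c (i + 1) := by
  refine Z.ext (fun k hk => ?_) (fun k hk => ?_) (fun k hk => ?_) (fun k hk => ?_) <;>
    simp <;> grind

lemma T_zero_apply {φ : CoregularModule K A} (hφ : φ ∈ Z.T 0) (y : A) :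
    φ y = Z.ε 0 y * φ (Z.E 0) + Z.β 0 y * φ (Z.b 0) + Z.γ 0 y * φ (Z.c 0) := by
  rw [← hφ y, mul_E_zero]
  simp only [map_add, map_smul, smul_eq_mul]

lemma T_succ_apply {i : ℕ} {φ : CoregularModule K A} (hφ : φ ∈ Z.T (i + 1)) (y : A) :
    φ y = Z.ε (i + 1) y * φ (Z.E (i + 1)) + Z.α i y * φ (Z.a i) +
      Z.β (i + 1) y * φ (Z.b (i + 1)) + Z.γ (i + 1) y * φ (Z.c (i + 1)) := by
  rw [← hφ y, mul_E_succ]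
  simp only [map_add, map_smul, smul_eq_mul]

/-- Exactness of `A E k → A E j → A E i`, given by right multiplications, in its dual form: a
functional that vanishes on the image of the first map factors through the second. -/
lemma exact_dualMap {i j k : ℕ} {g g' : A} (h : Z.E j * g = g) (h' : Z.E k * g' = g')
    (hg : g' * g = 0) (H : ∀ φ ∈ Z.T j, (∀ y, φ (y * g') = 0) →
      ∃ ψ : Module.Dual K A, (∀ y, ψ (y * Z.E i) = ψ y) ∧ ∀ y, ψ (y * g) = φ y) :
    Function.Exact (dualMap g h : Z.T i →ₗ[Aᵐᵒᵖ] Z.T j) (dualMap g' h' : Z.T j →ₗ[Aᵐᵒᵖ] Z.T k) := by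
  intro φ
  constructor
  · intro hφ
    obtain ⟨ψ, hψ, hψφ⟩ := H φ φ.2 fun y => DFunLike.congr_fun (congrArg Subtype.val hφ) y
    exact ⟨⟨ψ, hψ⟩, Subtype.ext (CoregularModule.ext hψφ)⟩
  · rintro ⟨ψ, rfl⟩
    refine Subtype.ext (CoregularModule.ext fun y => ?_)
    rw [dualMap_apply, dualMap_apply, mul_assoc, hg, mul_zero, map_zero]
    rfl

lemma T_succ_apply_of_a {i : ℕ} {φ : CoregularModule K A} (hφ : φ ∈ Z.T (i + 1))
    (h : ∀ y, φ (y * Z.a i) = 0) (y : A) : φ y = Z.ε (i + 1) y * φ (Z.E (i + 1)) +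
      Z.β (i + 1) y * φ (Z.b (i + 1)) := by
  have h1 := h (Z.E i)
  have h2 := h (Z.b i)
  rw [E_mul_a] at h1
  rw [b_mul_a] at h2
  rw [Z.T_succ_apply hφ y, h1, h2]
  ring

lemma T_zero_apply_of_c {φ : CoregularModule K A} (hφ : φ ∈ Z.T 0)
    (h : ∀ y, φ (y * Z.c 0) = 0) (y : A) : φ y = Z.ε 0 y * φ (Z.E 0) + Z.β 0 y * φ (Z.b 0) := by
  have h1 := h (Z.E 0)
  rw [E_mul_c] at h1
  rw [Z.T_zero_apply hφ y, h1]
  ring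

/-- The bound on `j` is needed: a preimage of `φ` involves the loop at `j + 2`, which is zero at the
last vertex. There the sequence fails to be exact, and the resolution starts. -/
lemma exact_a_a {j : ℕ} (hj : j + 3 < n) : Function.Exact
    (dualMap (Z.a (j + 1)) (Z.E_mul_a _) : Z.T (j + 2) →ₗ[Aᵐᵒᵖ] Z.T (j + 1))
    (dualMap (Z.a j) (Z.E_mul_a _) : Z.T (j + 1) →ₗ[Aᵐᵒᵖ] Z.T j) := by
  refine Z.exact_dualMap _ _ (Z.a_mul_a _ _) fun φ hφ h => ?_
  refine ⟨φ (Z.E (j + 1)) • Z.α (j + 1) + φ (Z.b (j + 1)) • Z.γ (j + 2), ?_, fun y => ?_⟩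
  · simp
  · rw [Z.T_succ_apply_of_a hφ h y]
    simp [show j + 1 + 1 < n by omega, show j + 2 + 1 < n by omega, mul_comm]

lemma exact_a_c (hn : 2 < n) : Function.Exact
    (dualMap (Z.a 0) (Z.E_mul_a _) : Z.T 1 →ₗ[Aᵐᵒᵖ] Z.T 0)
    (dualMap (Z.c 0) (Z.E_mul_c _) : Z.T 0 →ₗ[Aᵐᵒᵖ] Z.T 0) := by
  refine Z.exact_dualMap _ _ (by rw [← a_mul_b, mul_assoc, b_mul_a, ← a_mul_b, ← mul_assoc,
    a_mul_a, zero_mul]) fun φ hφ h => ?_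
  refine ⟨φ (Z.E 0) • Z.α 0 + φ (Z.b 0) • Z.γ 1, ?_, fun y => ?_⟩
  · simp
  · rw [Z.T_zero_apply_of_c hφ h y]
    simp [show 1 < n by omega, show 1 + 1 < n by omega, mul_comm]

lemma exact_c_b (hn : 1 < n) : Function.Exact
    (dualMap (Z.c 0) (Z.E_mul_c _) : Z.T 0 →ₗ[Aᵐᵒᵖ] Z.T 0)
    (dualMap (Z.b 0) (Z.E_mul_b _) : Z.T 0 →ₗ[Aᵐᵒᵖ] Z.T 1) := by
  refine Z.exact_dualMap _ _ (by rw [← a_mul_b, ← mul_assoc, b_mul_a, ← a_mul_b, mul_assoc,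
    b_mul_b, mul_zero]) fun φ hφ h => ?_
  refine ⟨φ (Z.E 0) • Z.γ 0, ?_, fun y => ?_⟩
  · simp
  · have h1 := h (Z.E 1)
    have h2 := h (Z.a 0)
    rw [E_mul_b] at h1
    rw [a_mul_b] at h2
    rw [Z.T_zero_apply hφ y, h1, h2]
    simp [hn, mul_comm]

lemma exact_b_b (j : ℕ) : Function.Exact
    (dualMap (Z.b j) (Z.E_mul_b _) : Z.T j →ₗ[Aᵐᵒᵖ] Z.T (j + 1))
    (dualMap (Z.b (j + 1)) (Z.E_mul_b _) : Z.T (j + 1) →ₗ[Aᵐᵒᵖ] Z.T (j + 2)) := by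
  refine Z.exact_dualMap _ _ (Z.b_mul_b _ _) fun φ hφ h => ?_
  refine ⟨φ (Z.E (j + 1)) • Z.β j + φ (Z.a j) • Z.γ j, ?_, fun y => ?_⟩
  · simp
  · have h1 := h (Z.E (j + 2))
    have h2 := h (Z.a (j + 1))
    rw [E_mul_b] at h1
    rw [a_mul_b] at h2
    rw [Z.T_succ_apply hφ y, h1, h2]
    simp [mul_comm]

end ZigzagCoordinates

/-! ### The minimal injective resolution of the regular module -/

namespace ZigzagCoordinates

open CoregularModule

variable {K : Type u} [Field K] {m : ℕ} {A : Type u} [Ring A] [Algebra K A]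
  (Z : ZigzagCoordinates K (m + 2) A)

/-- The sum of the trivial paths at all vertices but the last. The duals of `A E i` for these
vertices are projective. -/
def f : A := 1 - Z.E (m + 1)

lemma f_mul_f : Z.f * Z.f = Z.f := by
  simp [f, sub_mul, mul_sub]

lemma f_mul_E {i : ℕ} (hi : i ≤ m) : Z.f * Z.E i = Z.E i := by
  rw [f, sub_mul, one_mul, E_mul_E, if_neg (by omega), sub_zero]

/-- The sum of the loop coefficients. The form `(x, y) ↦ trace (x * y)` pairs `E i` with `c i` and
`a i` with `b i`; it is degenerate on `A`, but not between `f A` and `A f`. -/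
def trace : Module.Dual K A := ∑ i ∈ Finset.range (m + 1), Z.γ i

lemma trace_apply (x : A) : Z.trace x = ∑ i ∈ Finset.range (m + 1), Z.γ i x := by
  simp [trace]

lemma trace_mem : Z.trace ∈ dualOf K Z.f := fun y => by
  change Z.trace _ = Z.trace _
  rw [trace_apply, trace_apply]
  refine Finset.sum_congr rfl fun i hi => ?_
  have := Finset.mem_range.1 hi
  rw [f, mul_sub, mul_one, map_sub, γ_mul_E, if_neg (by omega), sub_zero]

@[simp] lemma trace_mul_E (x : A) (i : ℕ) : Z.trace (x * Z.E i) = Z.γ i x := by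
  rw [trace_apply]
  simp only [γ_mul_E, Finset.sum_ite_eq', Finset.mem_range]
  split_ifs with h
  · rfl
  · exact (Z.γ_eq_zero _ _ (by omega)).symm

@[simp] lemma trace_mul_a (x : A) (i : ℕ) :
    Z.trace (x * Z.a i) = if i < m then Z.β i x else 0 := by
  rw [trace_apply]
  simp only [γ_mul_a, ite_and, Finset.sum_ite_eq', Finset.mem_range]
  grind

@[simp] lemma trace_mul_b (x : A) (i : ℕ) : Z.trace (x * Z.b i) = Z.α i x := by
  rw [trace_apply]
  simp only [γ_mul_b, Finset.sum_ite_eq', Finset.mem_range]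
  split_ifs with h
  · rfl
  · exact (Z.α_eq_zero _ _ (by omega)).symm

@[simp] lemma trace_mul_c (x : A) (i : ℕ) :
    Z.trace (x * Z.c i) = if i ≤ m then Z.ε i x else 0 := by
  rw [trace_apply]
  simp only [γ_mul_c, ite_and, Finset.sum_ite_eq', Finset.mem_range]
  grind

/-- The coordinates of `x` are the values of `φ` at the basis elements paired with `E i`, `a i`,
`b i`, `c i` by the trace form. -/
lemma exists_trace_mul (φ : CoregularModule K A) (hφ : φ ∈ dualOf K Z.f) :
    ∃ x : A, Z.f * x = x ∧ ∀ y, Z.trace (x * y) = φ y := by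
  refine ⟨Z.mk (fun i => if i ≤ m then φ (Z.c i) else 0) (fun i => φ (Z.b i))
    (fun i => if i < m then φ (Z.a i) else 0) (fun i => φ (Z.E i)), ?_, fun y => ?_⟩
  · refine Z.ext' fun i => ?_
    simp only [f, sub_mul, one_mul, map_sub]
    simp
    grind
  · refine Z.dual_ext (φ := Z.trace ∘ₗ LinearMap.mulLeft K _) (ψ := (φ : Module.Dual K A))
      (fun i hi => ?_) (fun i hi => ?_) (fun i hi => ?_) (fun i hi => ?_) y
    · by_cases h : i < m + 1
      · simp [h]; rfl
      · have h2 : φ (Z.E i) = 0 := by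
          rw [← hφ, show i = m + 1 by omega, f, mul_sub, mul_one, E_mul_E_self, sub_self, map_zero]
        simp [h]; exact h2.symm
    · by_cases h : i < m
      · simp [h, hi]; rfl
      · have h2 : φ (Z.a i) = 0 := by
          rw [← hφ, show i = m by omega, f, mul_sub, mul_one, a_mul_E, sub_self, map_zero]
        simp [h]; exact h2.symm
    · have h : i < m + 1 := by omega
      simp [h]; rfl
    · have h : i ≤ m := by omega
      have h' : i < m + 2 := by omega
      simp [h, h']; rfl

lemma trace_mul_injective {x : A} (hx : Z.f * x = x) (h : ∀ y, Z.trace (x * y) = 0) : x = 0 := by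
  have h1 : Z.ε (m + 1) x = 0 := by rw [← hx, f, sub_mul, one_mul, map_sub, ε_E_mul]; simp
  have h2 : Z.β m x = 0 := by rw [← hx, f, sub_mul, one_mul, map_sub, β_E_mul]; simp
  refine Z.ext (fun i hi => ?_) (fun i hi => ?_) (fun i hi => ?_) (fun i hi => ?_)
  · by_cases h' : i ≤ m
    · simpa [h'] using h (Z.c i)
    · rw [show i = m + 1 by omega, h1, map_zero]
  · simpa using h (Z.b i)
  · by_cases h' : i < m
    · simpa [h'] using h (Z.a i)
    · rw [show i = m by omega, h2, map_zero]
  · simpa using h (Z.E i)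

/-- The trace form identifies `f A` with the dual of `A f`. -/
lemma projective_dualOf_f : Module.Projective Aᵐᵒᵖ (dualOf K Z.f) := by
  let P : Submodule Aᵐᵒᵖ A :=
    { carrier := {x | Z.f * x = x}
      add_mem' := fun {x y} hx hy => by
        change Z.f * (x + y) = x + y
        rw [mul_add, show Z.f * x = x from hx, show Z.f * y = y from hy]
      zero_mem' := mul_zero _
      smul_mem' := fun r x hx => by
        change Z.f * (x * r.unop) = x * r.unop
        rw [← mul_assoc, show Z.f * x = x from hx] }
  have hA : Module.Projective Aᵐᵒᵖ A :=
    Module.Projective.of_equiv (MulOpposite.opLinearEquiv Aᵐᵒᵖ).symm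
  have hP : Module.Projective Aᵐᵒᵖ P := Module.Projective.of_split P.subtype
    (LinearMap.codRestrict P (orbitMap Z.f) fun x => by
      change Z.f * (Z.f * x) = Z.f * x
      rw [← mul_assoc, f_mul_f]) (LinearMap.ext fun x => Subtype.ext x.2)
  let F : P →ₗ[Aᵐᵒᵖ] dualOf K Z.f := orbitMap ⟨Z.trace, Z.trace_mem⟩ ∘ₗ P.subtype
  refine Module.Projective.of_equiv (LinearEquiv.ofBijective F ⟨?_, ?_⟩)
  · rw [← LinearMap.ker_eq_bot, LinearMap.ker_eq_bot']
    intro x hx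
    exact Subtype.ext (Z.trace_mul_injective x.2 fun y =>
      DFunLike.congr_fun (congrArg Subtype.val hx) y)
  · intro φ
    obtain ⟨x, hx, h⟩ := Z.exists_trace_mul φ φ.2
    exact ⟨⟨x, hx⟩, Subtype.ext (CoregularModule.ext h)⟩

/-- `T i` is a direct summand of the dual of `A f`. -/
lemma projective_T {i : ℕ} (hi : i ≤ m) : Module.Projective Aᵐᵒᵖ (Z.T i) := by
  have := Z.projective_dualOf_f
  refine Module.Projective.of_split (dualMap (Z.E i) (Z.f_mul_E hi))
    (dualMap (Z.E i) (Z.E_mul_E_self i)) (LinearMap.ext fun φ => Subtype.ext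
      (CoregularModule.ext fun y => ?_))
  simp only [LinearMap.comp_apply, dualMap_apply, LinearMap.id_apply, mul_assoc, E_mul_E_self]
  exact φ.2 y

/-- The map `d : T m → T (m + 1)` is surjective but does not split: `c m` annihilates the functional
`α m` in `T (m + 1)`, but none of its preimages in `T m`. -/
lemma not_projective_T : ¬ Module.Projective Aᵐᵒᵖ (Z.T (m + 1)) := by
  intro h
  let d : Z.T m →ₗ[Aᵐᵒᵖ] Z.T (m + 1) := dualMap (Z.b m) (Z.E_mul_b m)
  have hd : Function.Surjective d := fun φ => by
    refine (Z.exact_b_b m φ).1 (Subtype.ext (CoregularModule.ext fun y => ?_))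
    rw [dualMap_apply, Z.b_eq_zero (m + 1) (by omega), mul_zero, map_zero]
    rfl
  obtain ⟨s, hs⟩ := Module.projective_lifting_property d LinearMap.id hd
  let α' : Z.T (m + 1) := ⟨Z.α m, fun y => by
    change Z.α m _ = Z.α m _
    simp⟩
  have h1 : (s α').1 (Z.c m) = 1 := by
    have := DFunLike.congr_fun (congrArg Subtype.val (LinearMap.congr_fun hs α')) (Z.a m)
    rw [LinearMap.comp_apply, dualMap_apply, a_mul_b] at this
    rw [this]
    change Z.α m _ = _
    simp
  have h2 : MulOpposite.op (Z.c m) • α' = 0 := Subtype.ext (CoregularModule.ext fun y => by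
    change Z.α m _ = 0
    simp)
  have h3 : MulOpposite.op (Z.c m) • s α' = 0 := by rw [← map_smul, h2, map_zero]
  have h4 : (s α').1 (Z.c m * 1) = 0 := DFunLike.congr_fun (congrArg Subtype.val h3) 1
  rw [mul_one, h1] at h4
  exact one_ne_zero h4

/-- The vertex of the socle of the `k`-th term of the resolution (apart from the dual of `A f` in
degree `0`): the sequence `m, m - 1, …, 0, 0, 1, 2, …`. -/
def vertexAt (m k : ℕ) : ℕ := if k ≤ m then m - k else k - (m + 1)

/-- The path inducing the `k`-th differential: the sequence
`a (m - 1), …, a 0, c 0, b 0, b 1, …`. -/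
def pathAt (k : ℕ) : A :=
  if k < m then Z.a (m - 1 - k) else if k = m then Z.c 0 else Z.b (k - (m + 1))

lemma E_mul_pathAt (k : ℕ) : Z.E (vertexAt m (k + 1)) * Z.pathAt k = Z.pathAt k := by
  unfold vertexAt pathAt
  split_ifs with h1 h2 h3 h4 h5
  · rw [show m - 1 - k = m - (k + 1) by omega, E_mul_a]
  all_goals try omega
  · rw [show k + 1 - (m + 1) = 0 by omega, E_mul_c]
  · rw [show k + 1 - (m + 1) = k - (m + 1) + 1 by omega, E_mul_b]

lemma isRad_pathAt (k : ℕ) : Z.IsRad (Z.pathAt k) := fun i => by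
  unfold pathAt
  split_ifs <;> simp

/-- The `k`-th differential of the resolution, on `T` in degree `0`. -/
def diff (k : ℕ) : Z.T (vertexAt m k) →ₗ[Aᵐᵒᵖ] Z.T (vertexAt m (k + 1)) :=
  dualMap (Z.pathAt k) (Z.E_mul_pathAt k)

/-- Transport of exactness along equalities of vertices and paths, which occur in the types. -/
lemma exact_dualMap_congr {i j k i' j' k' : ℕ} {g g' h h' : A} (hi : i = i') (hj : j = j')
    (hk : k = k') (hg : g = g') (hh : h = h') (p : Z.E j * g = g) (q : Z.E k * h = h)
    (p' : Z.E j' * g' = g') (q' : Z.E k' * h' = h')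
    (H : Function.Exact (dualMap g' p' : Z.T i' →ₗ[Aᵐᵒᵖ] Z.T j')
      (dualMap h' q' : Z.T j' →ₗ[Aᵐᵒᵖ] Z.T k')) :
    Function.Exact (dualMap g p : Z.T i →ₗ[Aᵐᵒᵖ] Z.T j) (dualMap h q : Z.T j →ₗ[Aᵐᵒᵖ] Z.T k) := by
  subst hi hj hk hg hh
  exact H

lemma exact_diff (k : ℕ) : Function.Exact (Z.diff k) (Z.diff (k + 1)) := by
  unfold diff
  -- The pairs of consecutive paths are `a, a`; `a 0, c 0`; `c 0, b 0`; `b, b`.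
  rcases lt_trichotomy (k + 1) m with h | h | h
  · obtain ⟨j, rfl⟩ : ∃ j, m = k + j + 2 := ⟨m - k - 2, by omega⟩
    refine Z.exact_dualMap_congr ?_ ?_ ?_ ?_ ?_ _ _ _ _ (Z.exact_a_a (j := j) (by omega))
    · rw [vertexAt, if_pos (by omega)]; omega
    · rw [vertexAt, if_pos (by omega)]; omega
    · rw [vertexAt, if_pos (by omega)]; omega
    · rw [pathAt, if_pos (by omega)]; congr 1; omega
    · rw [pathAt, if_pos (by omega)]; congr 1; omega
  · subst h
    refine Z.exact_dualMap_congr ?_ ?_ ?_ ?_ ?_ _ _ _ _ (Z.exact_a_c (by omega))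
    · rw [vertexAt, if_pos (by omega)]; omega
    · rw [vertexAt, if_pos (by omega)]; omega
    · rw [vertexAt, if_neg (by omega)]; omega
    · rw [pathAt, if_pos (by omega)]; congr 1; omega
    · rw [pathAt, if_neg (by omega), if_pos rfl]
  · rcases eq_or_lt_of_le (Nat.lt_succ_iff.1 h) with h' | h'
    · subst h'
      refine Z.exact_dualMap_congr ?_ ?_ ?_ ?_ ?_ _ _ _ _ (Z.exact_c_b (by omega))
      · rw [vertexAt, if_pos (by omega)]; omega
      · rw [vertexAt, if_neg (by omega)]; omega
      · rw [vertexAt, if_neg (by omega)]; omega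
      · rw [pathAt, if_neg (by omega), if_pos rfl]
      · rw [pathAt, if_neg (by omega), if_neg (by omega)]; congr 1; omega
    · obtain ⟨j, rfl⟩ : ∃ j, k = m + 1 + j := ⟨k - m - 1, by omega⟩
      refine Z.exact_dualMap_congr ?_ ?_ ?_ ?_ ?_ _ _ _ _ (Z.exact_b_b j)
      · rw [vertexAt, if_neg (by omega)]; omega
      · rw [vertexAt, if_neg (by omega)]; omega
      · rw [vertexAt, if_neg (by omega)]; omega
      · rw [pathAt, if_neg (by omega), if_neg (by omega)]; congr 1; omega
      · rw [pathAt, if_neg (by omega), if_neg (by omega)]; congr 1; omega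

/-- For `m = 0` the first differential is induced by `c 0`, otherwise by `a (m - 1)`. -/
lemma apply_of_diff_zero_eq_zero {φ : Z.T (vertexAt m 0)} (h : Z.diff 0 φ = 0) (y : A) :
    φ.1 y = Z.ε m y * φ.1 (Z.E m) + Z.β m y * φ.1 (Z.b m) := by
  have h (y : A) : φ.1 (y * Z.pathAt 0) = 0 := DFunLike.congr_fun (congrArg Subtype.val h) y
  have hφ := φ.2
  rcases Nat.eq_zero_or_pos m with h0 | h0
  · subst h0
    exact Z.T_zero_apply_of_c hφ h y
  · obtain ⟨j, rfl⟩ : ∃ j, m = j + 1 := ⟨m - 1, by omega⟩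
    exact Z.T_succ_apply_of_a hφ h y

lemma β_mem : Z.β m ∈ Z.T (vertexAt m 0) := fun y => by
  change Z.β m _ = Z.β m y
  simp [vertexAt]

/-- The embedding of `A` into the first term, given by the functionals `trace` and `β m`. The first
is faithful on `f A`, the second on the remaining summand `E (m + 1) A`. -/
def coaug : A →ₗ[Aᵐᵒᵖ] dualOf K Z.f × Z.T (vertexAt m 0) :=
  orbitMap (⟨Z.trace, Z.trace_mem⟩, ⟨Z.β m, Z.β_mem⟩)

lemma coaug_fst (x y : A) : (Z.coaug x).1.1 y = Z.trace (x * y) := rfl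
lemma coaug_snd (x y : A) : (Z.coaug x).2.1 y = Z.β m (x * y) := rfl

lemma coaug_injective : Function.Injective Z.coaug := by
  rw [← LinearMap.ker_eq_bot, LinearMap.ker_eq_bot']
  intro x hx
  have h1 (y : A) : Z.trace (x * y) = 0 := by rw [← coaug_fst, hx]; rfl
  have h2 (y : A) : Z.β m (x * y) = 0 := by rw [← coaug_snd, hx]; rfl
  refine Z.trace_mul_injective ?_ h1
  have h3 : Z.ε (m + 1) x = 0 := by simpa using h2 (Z.b m)
  have h4 : Z.β m x = 0 := by simpa using h2 1
  have h5 := Z.α_eq_zero (m + 1) x (by omega)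
  have h6 := Z.γ_eq_zero (m + 1) x (by omega)
  refine Z.ext' fun i => ?_
  simp only [f, sub_mul, one_mul, map_sub]
  simp
  grind

lemma exact_coaug : Function.Exact Z.coaug (Z.diff 0 ∘ₗ LinearMap.snd Aᵐᵒᵖ _ _) := by
  rintro ⟨φ, ψ⟩
  constructor
  · intro h
    have hψ (y : A) : ψ.1 y = Z.ε m y * ψ.1 (Z.E m) + Z.β m y * ψ.1 (Z.b m) :=
      Z.apply_of_diff_zero_eq_zero h y
    obtain ⟨x, hx, hφ⟩ := Z.exists_trace_mul φ φ.2
    have h1 : Z.ε (m + 1) x = 0 := by rw [← hx, f, sub_mul, one_mul, map_sub, ε_E_mul]; simp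
    have h2 : Z.β m x = 0 := by rw [← hx, f, sub_mul, one_mul, map_sub, β_E_mul]; simp
    -- `x` lies in `f A` and takes care of `φ`; the correction by elements of `E (m + 1) A`, which
    -- the trace does not see, takes care of `ψ`.
    refine ⟨x + ψ.1 (Z.b m) • Z.E (m + 1) + ψ.1 (Z.E m) • Z.b m, Prod.ext
      (Subtype.ext (CoregularModule.ext fun y => ?_))
      (Subtype.ext (CoregularModule.ext fun y => ?_))⟩
    · have h3 : Z.trace (Z.E (m + 1) * y) = 0 := by
        rw [trace_apply]
        refine Finset.sum_eq_zero fun i hi => ?_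
        have := Finset.mem_range.1 hi
        rw [γ_E_mul, if_neg (by omega)]
      have h4 : Z.trace (Z.b m * y) = 0 := by
        rw [trace_apply]
        refine Finset.sum_eq_zero fun i hi => ?_
        have := Finset.mem_range.1 hi
        rw [γ_b_mul, if_neg (by omega)]
      rw [coaug_fst]
      simp only [add_mul, smul_mul_assoc, map_add, map_smul, h3, h4, hφ]
      simp
    · rw [coaug_snd]
      change _ = ψ.1 y
      rw [hψ y]
      simp only [add_mul, smul_mul_assoc, map_add, map_smul, β_mul, h1, h2]
      simp
      ring
  · rintro ⟨x, hx⟩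
    obtain ⟨-, rfl⟩ := Prod.ext_iff.1 hx
    refine Subtype.ext (CoregularModule.ext fun y => ?_)
    change Z.β m (x * (y * Z.pathAt 0)) = 0
    rw [← mul_assoc, pathAt]
    split_ifs
    · simp
    · simp
    · omega

/-- The differentials are induced by radical elements, so they vanish on the socle. -/
lemma diff_eq_zero_of_socle {k : ℕ} {φ : Z.T (vertexAt m k)}
    (h : ∀ x, Z.IsRad x → MulOpposite.op x • φ = 0) : Z.diff k φ = 0 :=
  Subtype.ext (CoregularModule.ext fun y => by
    have := DFunLike.congr_fun (congrArg Subtype.val (h _ ((Z.isRad_pathAt k).mul_left y))) 1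
    change φ.1 (y * Z.pathAt k * 1) = 0 at this
    rwa [mul_one] at this)

/-- The minimal injective resolution of the regular module. From degree `2 * m + 3` on the terms are
zero. -/
def resolution : MinimalInjectiveResolution Aᵐᵒᵖ A where
  I
    | 0 => ModuleCat.of Aᵐᵒᵖ (dualOf K Z.f × Z.T (vertexAt m 0))
    | k + 1 => ModuleCat.of Aᵐᵒᵖ (Z.T (vertexAt m (k + 1)))
  injective
    | 0 => by
      have h1 := dualOf_injective (K := K) Z.f_mul_f
      have h2 := dualOf_injective (K := K) (Z.E_mul_E_self (vertexAt m 0))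
      exact Module.Injective.prod _ _
    | k + 1 => dualOf_injective (Z.E_mul_E_self _)
  ι := Z.coaug
  d
    | 0 => Z.diff 0 ∘ₗ LinearMap.snd Aᵐᵒᵖ _ _
    | k + 1 => Z.diff (k + 1)
  ι_injective := Z.coaug_injective
  exact_zero := Z.exact_coaug
  exact_succ
    | 0 => fun φ => (Z.exact_diff 0 φ).trans
        ⟨fun ⟨ψ, h⟩ => ⟨(0, ψ), h⟩, fun ⟨ψ, h⟩ => ⟨ψ.2, h⟩⟩
    | k + 1 => Z.exact_diff (k + 1)
  essential_zero := Z.essential_of_socle_le fun φ hφ => (Z.exact_coaug φ).1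
    (Z.diff_eq_zero_of_socle fun x hx => congrArg Prod.snd (hφ x hx))
  essential_succ
    | 0 => Z.essential_of_socle_le fun φ hφ => by
      obtain ⟨ψ, h⟩ := (Z.exact_diff 0 φ).1 (Z.diff_eq_zero_of_socle hφ)
      exact ⟨(0, ψ), h⟩
    | k + 1 => Z.essential_of_socle_le fun φ hφ =>
      (Z.exact_diff (k + 1) φ).1 (Z.diff_eq_zero_of_socle hφ)

theorem dominantDimension_eq {K : Type u} [Field K] {m : ℕ} {A : Type u} [Ring A] [Algebra K A]
    (Z : ZigzagCoordinates K (m + 2) A) : dominantDimension A = ((2 * m + 2 : ℕ) : ℕ∞) := by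
  refine Z.resolution.moduleDominantDimension_eq (2 * m + 2) (fun i hi => ?_) ?_
  · cases i with
    | zero =>
      have h1 := Z.projective_dualOf_f
      have h2 : Module.Projective Aᵐᵒᵖ (Z.T (vertexAt m 0)) :=
        Z.projective_T (by rw [vertexAt]; split_ifs <;> omega)
      change Module.Projective Aᵐᵒᵖ (dualOf K Z.f × Z.T (vertexAt m 0))
      infer_instance
    | succ i => exact Z.projective_T (by rw [vertexAt]; split_ifs <;> omega)
  · intro h
    refine Z.not_projective_T ?_
    have h' : Module.Projective Aᵐᵒᵖ (Z.T (vertexAt m (2 * m + 1 + 1))) := h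
    rwa [show vertexAt m (2 * m + 1 + 1) = m + 1 by rw [vertexAt]; split_ifs <;> omega] at h'

end ZigzagCoordinates

/-! ### Simple modules and global dimension -/

section ProjectiveDimension

variable {R : Type u} [Ring R] {L M N : Type u} [AddCommGroup L] [Module R L] [AddCommGroup M]
  [Module R M] [AddCommGroup N] [Module R N]

/-- The projective dimension of an unbundled module is at most `d`. -/
abbrev ProjDimLE (R : Type u) [Ring R] (M : Type u) [AddCommGroup M] [Module R M] (d : ℕ) : Prop :=
  HasProjectiveDimensionLE (ModuleCat.of R M) d

lemma ProjDimLE.mono {d d' : ℕ} (h : ProjDimLE R M d) (hd : d ≤ d') : ProjDimLE R M d' :=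
  haveI : HasProjectiveDimensionLT (ModuleCat.of R M) (d + 1) := h
  hasProjectiveDimensionLT_of_ge (ModuleCat.of R M) (d + 1) (d' + 1) (by omega)

lemma ProjDimLE.of_equiv {d : ℕ} (h : ProjDimLE R M d) (e : M ≃ₗ[R] N) : ProjDimLE R N d :=
  haveI : HasProjectiveDimensionLT (ModuleCat.of R M) (d + 1) := h
  hasProjectiveDimensionLT_of_iso e.toModuleIso (d + 1)

lemma ProjDimLE.of_projective [Module.Projective R M] (d : ℕ) : ProjDimLE R M d := by
  have : Projective (ModuleCat.of R M) := (IsProjective.iff_projective M).1 inferInstance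
  exact ProjDimLE.mono ((projective_iff_hasProjectiveDimensionLE_zero _).1 this) d.zero_le

lemma shortExact_of {f : L →ₗ[R] M} {g : M →ₗ[R] N} (hf : Function.Injective f)
    (hg : Function.Surjective g) (h : Function.Exact f g) :
    (ShortComplex.mk (ModuleCat.ofHom f) (ModuleCat.ofHom g)
      (ModuleCat.hom_ext h.linearMap_comp_eq_zero)).ShortExact :=
  ModuleCat.shortComplex_shortExact _ h hf hg

lemma ProjDimLE.of_exact_right {f : L →ₗ[R] M} {g : M →ₗ[R] N} (hf : Function.Injective f)
    (hg : Function.Surjective g) (h : Function.Exact f g) {d : ℕ} (hL : ProjDimLE R L d)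
    (hM : ProjDimLE R M (d + 1)) : ProjDimLE R N (d + 1) :=
  (shortExact_of hf hg h).hasProjectiveDimensionLT_X₃ (d + 1) hL hM

lemma ProjDimLE.of_exact_middle {f : L →ₗ[R] M} {g : M →ₗ[R] N} (hf : Function.Injective f)
    (hg : Function.Surjective g) (h : Function.Exact f g) {d : ℕ} (hL : ProjDimLE R L d)
    (hN : ProjDimLE R N d) : ProjDimLE R M d :=
  (shortExact_of hf hg h).hasProjectiveDimensionLT_X₂ (d + 1) hL hN

/-- A bound for the simple modules bounds all modules of finite length. -/
lemma ProjDimLE.of_isFiniteLength {d : ℕ}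
    (hd : ∀ (S : Type u) [AddCommGroup S] [Module R S], IsSimpleModule R S → ProjDimLE R S d)
    (hM : IsFiniteLength R M) : ProjDimLE R M d := by
  induction hM with
  | of_subsingleton => exact .of_projective d
  | @of_simple_quotient M _ _ N _ _ ih =>
    exact .of_exact_middle N.injective_subtype N.mkQ_surjective
      (LinearMap.exact_subtype_mkQ N) ih (hd _ inferInstance)

end ProjectiveDimension

section RightIdeal

variable {A : Type u} [Ring A]

lemma mem_rightIdeal {x z : A} : z ∈ rightIdeal x ↔ ∃ y, x * y = z := by
  rw [Submodule.mem_span_singleton]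
  exact ⟨fun ⟨r, h⟩ => ⟨r.unop, h⟩, fun ⟨y, h⟩ => ⟨MulOpposite.op y, h⟩⟩

lemma mul_mem_rightIdeal (x y : A) : x * y ∈ rightIdeal x := mem_rightIdeal.2 ⟨y, rfl⟩

lemma self_mem_rightIdeal (x : A) : x ∈ rightIdeal x := mem_rightIdeal.2 ⟨1, mul_one x⟩

lemma mem_rightIdeal_of_idem {e z : A} (he : e * e = e) : z ∈ rightIdeal e ↔ e * z = z := by
  rw [mem_rightIdeal]
  constructor
  · rintro ⟨y, rfl⟩
    rw [← mul_assoc, he]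
  · intro h
    exact ⟨z, h⟩

lemma rightIdeal_projective {e : A} (he : e * e = e) :
    Module.Projective Aᵐᵒᵖ (rightIdeal e) := by
  have hA : Module.Projective Aᵐᵒᵖ A :=
    Module.Projective.of_equiv (MulOpposite.opLinearEquiv Aᵐᵒᵖ).symm
  exact Module.Projective.of_split (rightIdeal e).subtype
    (LinearMap.codRestrict _ (orbitMap e) fun x => mul_mem_rightIdeal e x)
    (LinearMap.ext fun x => Subtype.ext ((mem_rightIdeal_of_idem he).1 x.2))

/-- Left multiplication by `g` gives an exact sequence `0 → L → e A → g A → 0`. -/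
lemma ProjDimLE.of_leftMul {e g l : A} (he : e * e = e) (hge : g * e = g)
    (hl : ∀ x, e * x = x → (g * x = 0 ↔ x ∈ rightIdeal l)) (hel : e * l = l) {d : ℕ}
    (hd : ProjDimLE Aᵐᵒᵖ (rightIdeal l) d) : ProjDimLE Aᵐᵒᵖ (rightIdeal g) (d + 1) := by
  have hle : rightIdeal l ≤ rightIdeal e := by
    rw [Submodule.span_singleton_le_iff_mem]
    exact (mem_rightIdeal_of_idem he).2 hel
  have := rightIdeal_projective he
  let F : rightIdeal e →ₗ[Aᵐᵒᵖ] rightIdeal g :=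
    LinearMap.codRestrict _ (orbitMap g) (fun x => mul_mem_rightIdeal g x) ∘ₗ
      (rightIdeal e).subtype
  refine .of_exact_right (f := Submodule.inclusion hle) (g := F)
    (Submodule.inclusion_injective hle) ?_ ?_ hd (.of_projective _)
  · rintro ⟨z, hz⟩
    obtain ⟨y, rfl⟩ := mem_rightIdeal.1 hz
    refine ⟨⟨e * y, mul_mem_rightIdeal e y⟩, Subtype.ext ?_⟩
    change g * (e * y) = _
    rw [← mul_assoc, hge]
  · rintro ⟨x, hx⟩
    rw [Set.mem_range]
    refine Subtype.ext_iff.trans ((hl x ((mem_rightIdeal_of_idem he).1 hx)).trans ?_)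
    constructor
    · intro h
      exact ⟨⟨x, h⟩, rfl⟩
    · rintro ⟨y, hy⟩
      rw [← show (y : A) = x from congrArg Subtype.val hy]
      exact y.2

end RightIdeal

namespace ZigzagCoordinates

variable {K : Type u} [Field K] {n : ℕ} {A : Type u} [Ring A] [Algebra K A]
  (Z : ZigzagCoordinates K n A)

/-- The condition on `β` says that `b (i - 1)` does not occur; it is void for `i = 0`. -/
lemma mem_rightIdeal_a {i : ℕ} {x : A} : x ∈ rightIdeal (Z.a i) ↔
    Z.E i * x = x ∧ Z.ε i x = 0 ∧ ∀ j, j + 1 = i → Z.β j x = 0 := by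
  constructor
  · intro h
    obtain ⟨y, rfl⟩ := mem_rightIdeal.1 h
    simp [← mul_assoc]
  · rintro ⟨h1, h2, h3⟩
    refine mem_rightIdeal.2 ⟨Z.α i x • Z.E (i + 1) + Z.γ i x • Z.b i, ?_⟩
    rw [← h1]
    have := Z.α_eq_zero i x
    have := Z.γ_eq_zero i x
    refine Z.ext' fun k => ?_
    have := h3 k
    simp
    grind

lemma mem_rightIdeal_c {i : ℕ} (hi : i + 1 < n) {x : A} : x ∈ rightIdeal (Z.c i) ↔
    Z.E i * x = x ∧ Z.ε i x = 0 ∧ Z.α i x = 0 ∧ ∀ j, j + 1 = i → Z.β j x = 0 := by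
  constructor
  · intro h
    obtain ⟨y, rfl⟩ := mem_rightIdeal.1 h
    simp [← mul_assoc]
  · rintro ⟨h1, h2, h3, h4⟩
    refine mem_rightIdeal.2 ⟨Z.γ i x • Z.E i, ?_⟩
    rw [← h1]
    refine Z.ext' fun k => ?_
    have := h4 k
    simp
    grind

/-- The kernel of left multiplication by `a i` on `E (i + 1) A`. -/
lemma a_mul_eq_zero_iff {i : ℕ} {x : A} (hx : Z.E (i + 1) * x = x) :
    Z.a i * x = 0 ↔ x ∈ rightIdeal (Z.a (i + 1)) := by
  rw [mem_rightIdeal_a]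
  constructor
  · intro h
    refine ⟨hx, ?_, fun j hj => ?_⟩
    · simpa using congrArg (Z.α i) h
    · obtain rfl : j = i := by omega
      simpa using congrArg (Z.γ j) h
  · rintro ⟨-, h1, h2⟩
    refine Z.ext' fun k => ?_
    have := h2 i rfl
    simp
    grind

lemma projDimLE_rightIdeal_a (k : ℕ) :
    ∀ i, n ≤ i + k + 1 → ProjDimLE Aᵐᵒᵖ (rightIdeal (Z.a i)) k := by
  induction k with
  | zero =>
    intro i hi
    have : Subsingleton (rightIdeal (Z.a i)) := by
      rw [Z.a_eq_zero i (by omega), Submodule.subsingleton_iff_eq_bot]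
      simp
    exact .of_projective _
  | succ k ih =>
    intro i hi
    exact .of_leftMul (Z.E_mul_E_self (i + 1)) (Z.a_mul_E i) (fun x => Z.a_mul_eq_zero_iff)
      (Z.E_mul_a (i + 1)) (ih (i + 1) (by omega))

/-- Left multiplication by `c 0` on `E 0 A` has the kernel `a 0 A`. The bound is not sharp. -/
lemma projDimLE_rightIdeal_c_zero (hn : 1 < n) : ProjDimLE Aᵐᵒᵖ (rightIdeal (Z.c 0)) (n + 1) := by
  refine .of_leftMul (Z.E_mul_E_self 0) ?_ (fun x hx => ?_) (Z.E_mul_a 0)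
    (Z.projDimLE_rightIdeal_a n 0 (by omega))
  · refine Z.ext' fun k => ?_
    simp; grind
  · rw [mem_rightIdeal_a]
    constructor
    · intro h
      refine ⟨hx, ?_, fun j hj => by omega⟩
      simpa [hn] using congrArg (Z.γ 0) h
    · rintro ⟨-, h1, h2⟩
      refine Z.ext' fun k => ?_
      simp
      grind

/-- `M` is isomorphic to the simple right module at the vertex `i`: it is generated by an element
whose annihilator consists of the elements without `i`-th trivial path. -/
def IsSimpleAt (i : ℕ) (M : Type u) [AddCommGroup M] [Module Aᵐᵒᵖ M] : Prop :=
  ∃ s : M, Function.Surjective (orbitMap s : A →ₗ[Aᵐᵒᵖ] M) ∧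
    ∀ x, MulOpposite.op x • s = 0 ↔ Z.ε i x = 0

variable {Z} in
lemma IsSimpleAt.equiv {i : ℕ} {M N : Type u} [AddCommGroup M] [Module Aᵐᵒᵖ M] [AddCommGroup N]
    [Module Aᵐᵒᵖ N] (hM : Z.IsSimpleAt i M) (hN : Z.IsSimpleAt i N) : Nonempty (M ≃ₗ[Aᵐᵒᵖ] N) := by
  obtain ⟨s, hs, hs'⟩ := hM
  obtain ⟨t, ht, ht'⟩ := hN
  have h : LinearMap.ker (orbitMap s : A →ₗ[Aᵐᵒᵖ] M) =
      LinearMap.ker (orbitMap t : A →ₗ[Aᵐᵒᵖ] N) :=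
    Submodule.ext fun x => (hs' x).trans (ht' x).symm
  exact ⟨(LinearMap.quotKerEquivOfSurjective _ hs).symm.trans
    ((Submodule.quotEquivOfEq _ _ h).trans (LinearMap.quotKerEquivOfSurjective _ ht))⟩

lemma isSimpleAt_c {i : ℕ} (hi : i + 1 < n) : Z.IsSimpleAt i (rightIdeal (Z.c i)) := by
  refine ⟨⟨Z.c i, self_mem_rightIdeal _⟩, ?_, fun x => ?_⟩
  · rintro ⟨z, hz⟩
    obtain ⟨y, rfl⟩ := mem_rightIdeal.1 hz
    exact ⟨y, rfl⟩
  · rw [Subtype.ext_iff]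
    change Z.c i * x = 0 ↔ _
    constructor
    · intro h
      simpa [hi] using congrArg (Z.γ i) h
    · intro h
      refine Z.ext' fun k => ?_
      simp
      grind

/-- The simple module at `i + 1` as the quotient of `a i A` by its socle `c i A`. -/
lemma isSimpleAt_quotient {i : ℕ} (hi : i + 1 < n) : Z.IsSimpleAt (i + 1)
    (rightIdeal (Z.a i) ⧸ (rightIdeal (Z.c i)).submoduleOf (rightIdeal (Z.a i))) := by
  refine ⟨Submodule.Quotient.mk ⟨Z.a i, self_mem_rightIdeal _⟩, ?_, fun x => ?_⟩
  · intro q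
    obtain ⟨⟨z, hz⟩, rfl⟩ := Submodule.Quotient.mk_surjective _ q
    obtain ⟨y, rfl⟩ := mem_rightIdeal.1 hz
    exact ⟨y, rfl⟩
  · rw [← Submodule.Quotient.mk_smul, Submodule.Quotient.mk_eq_zero]
    change Z.a i * x ∈ rightIdeal (Z.c i) ↔ _
    rw [Z.mem_rightIdeal_c hi]
    simp [← mul_assoc]

lemma projDimLE_of_isSimpleAt (i : ℕ) (hi : i < n) (hn : 2 ≤ n) (M : Type u) [AddCommGroup M]
    [Module Aᵐᵒᵖ M] (hM : Z.IsSimpleAt i M) : ProjDimLE Aᵐᵒᵖ M (n + 1 + i) := by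
  induction i generalizing M with
  | zero =>
    obtain ⟨e⟩ := (Z.isSimpleAt_c (i := 0) (by omega)).equiv hM
    exact (Z.projDimLE_rightIdeal_c_zero (by omega)).of_equiv e
  | succ i ih =>
    obtain ⟨e⟩ := (Z.isSimpleAt_quotient hi).equiv hM
    have hle : rightIdeal (Z.c i) ≤ rightIdeal (Z.a i) := by
      rw [Submodule.span_singleton_le_iff_mem, ← a_mul_b]
      exact mul_mem_rightIdeal _ _
    refine ProjDimLE.of_equiv (ProjDimLE.of_exact_right (d := n + 1 + i)
      (f := Submodule.inclusion hle)
      (Submodule.inclusion_injective hle) (Submodule.mkQ_surjective _) ?_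
      (ih (by omega) _ (Z.isSimpleAt_c hi))
      ((Z.projDimLE_rightIdeal_a n i (by omega)).mono (by omega))) e
    rw [LinearMap.exact_iff, Submodule.ker_mkQ, Submodule.range_inclusion]
    rfl

/-- If `s * x ≠ 0`, then `s = s * x * y` for some `y`, so `(x * y) ^ 3 = 0` gives `s = 0`. -/
lemma op_smul_eq_zero_of_isRad {S : Type u} [AddCommGroup S] [Module Aᵐᵒᵖ S]
    (hS : IsSimpleModule Aᵐᵒᵖ S) {x : A} (hx : Z.IsRad x) (s : S) : MulOpposite.op x • s = 0 := by
  by_contra h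
  obtain ⟨y, hy⟩ := Submodule.mem_span_singleton.1
    ((IsSimpleModule.span_singleton_eq_top Aᵐᵒᵖ h).symm ▸ Submodule.mem_top :
      s ∈ Submodule.span Aᵐᵒᵖ {MulOpposite.op x • s})
  have hxy : Z.IsRad (x * y.unop) := hx.mul_right _
  have h1 : MulOpposite.op (x * y.unop) • s = s := by
    rw [MulOpposite.op_mul, MulOpposite.op_unop, mul_smul, hy]
  have h2 : MulOpposite.op (x * y.unop * (x * y.unop) * (x * y.unop)) • s = s := by
    rw [MulOpposite.op_mul, MulOpposite.op_mul (x * y.unop), mul_smul, mul_smul, h1, h1, h1]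
  rw [hxy.mul_mul_eq_zero hxy hxy, MulOpposite.op_zero, zero_smul] at h2
  exact h (by rw [← h2, smul_zero])

lemma isSimpleAt_of_ne_zero {S : Type u} [AddCommGroup S] [Module Aᵐᵒᵖ S]
    (hS : IsSimpleModule Aᵐᵒᵖ S) {i : ℕ} {s : S} (hs : MulOpposite.op (Z.E i) • s ≠ 0) :
    i < n ∧ Z.IsSimpleAt i S := by
  have hi : i < n := by
    by_contra h
    exact hs (by rw [Z.E_eq_zero i (by omega), MulOpposite.op_zero, zero_smul])
  have key (x : A) : MulOpposite.op x • MulOpposite.op (Z.E i) • s =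
      MulOpposite.op (algebraMap K A (Z.ε i x)) • MulOpposite.op (Z.E i) • s := by
    rw [← sub_eq_zero, ← sub_smul, smul_smul, ← MulOpposite.op_sub, ← MulOpposite.op_mul]
    refine Z.op_smul_eq_zero_of_isRad hS (fun j => ?_) s
    rw [ε_E_mul, map_sub, Algebra.algebraMap_eq_smul_one, map_smul]
    split_ifs with h
    · subst h
      rw [Z.ε_one j hi]
      simp
    · rfl
  refine ⟨hi, MulOpposite.op (Z.E i) • s, fun t => ?_, fun x => ?_⟩
  · obtain ⟨y, hy⟩ := Submodule.mem_span_singleton.1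
      ((IsSimpleModule.span_singleton_eq_top Aᵐᵒᵖ hs).symm ▸ Submodule.mem_top :
        t ∈ Submodule.span Aᵐᵒᵖ {MulOpposite.op (Z.E i) • s})
    exact ⟨y.unop, hy⟩
  · rw [key]
    constructor
    · intro h
      by_contra h0
      apply hs
      have h1 : MulOpposite.op (algebraMap K A (Z.ε i x)⁻¹) •
          MulOpposite.op (algebraMap K A (Z.ε i x)) • MulOpposite.op (Z.E i) • s = 0 := by
        rw [h, smul_zero]
      rwa [smul_smul (MulOpposite.op _), ← MulOpposite.op_mul, ← map_mul, mul_inv_cancel₀ h0,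
        map_one, MulOpposite.op_one, one_smul] at h1
    · intro h
      rw [h, map_zero, MulOpposite.op_zero, zero_smul]

/-- Every simple module is the simple module at some vertex. -/
lemma exists_isSimpleAt {S : Type u} [AddCommGroup S] [Module Aᵐᵒᵖ S]
    (hS : IsSimpleModule Aᵐᵒᵖ S) : ∃ i < n, Z.IsSimpleAt i S := by
  have := IsSimpleModule.nontrivial Aᵐᵒᵖ S
  obtain ⟨s, hs⟩ := exists_ne (0 : S)
  have h : ∃ i, MulOpposite.op (Z.E i) • s ≠ 0 := by
    by_contra! h
    apply hs
    rw [← one_smul Aᵐᵒᵖ s, ← MulOpposite.op_one, ← Z.sum_E, Finset.op_sum, Finset.sum_smul]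
    exact Finset.sum_eq_zero fun i _ => h i
  obtain ⟨i, hi⟩ := h
  exact ⟨i, Z.isSimpleAt_of_ne_zero hS hi⟩

theorem hasFiniteGlobalDimension {K : Type u} [Field K] {n : ℕ} {A : Type u} [Ring A] [Algebra K A]
    (Z : ZigzagCoordinates K n A) (hn : 2 ≤ n) : HasFiniteGlobalDimension A := by
  refine ⟨2 * n + 1, fun M hM => ?_⟩
  have := Z.finiteDimensional
  have : IsArtinianRing Aᵐᵒᵖ := IsArtinianRing.of_finite K _
  refine ProjDimLE.of_isFiniteLength (M := M) (fun S _ _ hS => ?_)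
    (isFiniteLength_iff_isNoetherian_isArtinian.2 ⟨inferInstance, inferInstance⟩)
  obtain ⟨i, hi, h⟩ := Z.exists_isSimpleAt hS
  exact (Z.projDimLE_of_isSimpleAt i hi hn S h).mono (by omega)

end ZigzagCoordinates

/-! ### Stratification by proper standard modules -/

section Filtration

variable {R : Type u} [Ring R] {ι : Type} {X : ι → ModuleCat.{u} R} {M : Type u} [AddCommGroup M]
  [Module R M]

/-- A chain of submodules from `⊥` to `N` with subquotients in the family `X`. -/
def HasChainTo (X : ι → ModuleCat.{u} R) (N : Submodule R M) : Prop :=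
  ∃ (l : ℕ) (F : ℕ → Submodule R M), Monotone F ∧ F 0 = ⊥ ∧ F l = N ∧
    ∀ k < l, ∃ i, Nonempty ((F (k + 1) ⧸ (F k).submoduleOf (F (k + 1))) ≃ₗ[R] X i)

lemma hasChainTo_bot : HasChainTo X (⊥ : Submodule R M) :=
  ⟨0, fun _ => ⊥, monotone_const, rfl, rfl, by simp⟩

lemma HasChainTo.step {N N' : Submodule R M} (h : HasChainTo X N) (hle : N ≤ N') {i : ι}
    (e : Nonempty ((N' ⧸ N.submoduleOf N') ≃ₗ[R] X i)) : HasChainTo X N' := by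
  obtain ⟨l, F, hF, h0, rfl, hX⟩ := h
  obtain ⟨G, hG⟩ : ∃ G : ℕ → Submodule R M, ∀ k, G k = if k ≤ l then F k else N' :=
    ⟨_, fun _ => rfl⟩
  have hGF (k : ℕ) (hk : k ≤ l) : G k = F k := by rw [hG, if_pos hk]
  have hGN (k : ℕ) (hk : l < k) : G k = N' := by rw [hG, if_neg (by omega)]
  refine ⟨l + 1, G, fun a b hab => ?_, by rw [hGF 0 l.zero_le, h0], hGN _ l.lt_succ_self,
    fun k hk => ?_⟩
  · rw [hG, hG]
    split_ifs with h1 h2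
    · exact hF hab
    · exact (hF h1).trans hle
    · omega
    · exact le_rfl
  · rcases Nat.lt_succ_iff_lt_or_eq.1 hk with h | rfl
    · rw [hGF (k + 1) h, hGF k h.le]
      exact hX k h
    · rw [hGN (k + 1) k.lt_succ_self, hGF k le_rfl]
      exact ⟨i, e⟩

end Filtration

namespace ZigzagCoordinates

variable {K : Type u} [Field K] {n : ℕ} {A : Type u} [Ring A] [Algebra K A]
  (Z : ZigzagCoordinates K n A)

/-- The Jacobson radical is the span of the arrows and loops. -/
lemma mem_jacobson_iff {x : A} : x ∈ Ring.jacobson A ↔ Z.IsRad x := by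
  rw [← Ideal.jacobson_bot, Ideal.mem_jacobson_iff]
  constructor
  · intro h i
    by_contra h0
    have hi : i < n := by
      by_contra hi
      exact h0 (Z.ε_eq_zero i x (by omega))
    -- If `ε i x = r ≠ 0`, the element `1 - r⁻¹ x` has no left inverse, by its `i`-th coordinate.
    obtain ⟨z, hz⟩ := h (-((Z.ε i x)⁻¹ • 1))
    have := congrArg (Z.ε i) ((Submodule.mem_bot A).1 hz)
    simp [ε_mul, Z.ε_one i hi] at this
    field_simp at this
    simp at this
  · intro hx y
    -- The inverse of `1 + y * x` is a finite geometric series.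
    refine ⟨1 - y * x + y * x * (y * x), (Submodule.mem_bot A).2 ?_⟩
    have h := (hx.mul_left y).mul_mul_eq_zero (hx.mul_left y) (hx.mul_left y)
    calc _ = y * x * (y * x) * (y * x) := by noncomm_ring
      _ = 0 := h

variable {Z} in
lemma IsRad.eq_zero_of_idem {x : A} (hx : Z.IsRad x) (h : x * x = x) : x = 0 := by
  have := hx.mul_mul_eq_zero hx hx
  rwa [h, h] at this

/-- The ordered sequence of trivial paths. -/
def idem (i : Fin n) : A := Z.E i

lemma completeOrthogonalIdempotents : CompleteOrthogonalIdempotents Z.idem where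
  idem i := Z.E_mul_E_self i
  ortho i j h := by
    change Z.E i * Z.E j = 0
    rw [E_mul_E, if_neg (by rwa [Fin.val_inj])]
  complete := by
    rw [← Z.sum_E, ← Fin.sum_univ_eq_sum_range]
    rfl

lemma ε_E_self {i : ℕ} (hi : i < n) : Z.ε i (Z.E i) = 1 := by simp [hi]

variable {Z} in
lemma isRad_of_E_mul {i : ℕ} {x : A} (h : Z.E i * x = x) (h0 : Z.ε i x = 0) : Z.IsRad x :=
  fun k => by
    rw [← h, ε_E_mul]
    split_ifs with hk
    · rw [hk, h0]
    · rfl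

/-- In a decomposition of `E i` one summand lies in the radical, where the only idempotent is
`0`. -/
lemma isPrimitiveIdempotentElem (i : Fin n) : IsPrimitiveIdempotentElem (Z.idem i) := by
  refine ⟨Z.E_mul_E_self i, fun h => ?_, fun f g hf hg hfg hgf h => ?_⟩
  · have := congrArg (Z.ε i) h
    rw [map_zero] at this
    exact one_ne_zero ((Z.ε_E_self i.2).symm.trans this)
  · replace h : Z.E i = f + g := h
    have hf' : f * f = f := hf
    have hg' : g * g = g := hg
    have h1 : Z.E i * f = f := by rw [h, add_mul, hf', hgf, add_zero]
    have h2 : Z.E i * g = g := by rw [h, add_mul, hg', hfg, zero_add]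
    have h3 : Z.ε i f * Z.ε i g = 0 := by rw [← ε_mul, hfg, map_zero]
    rcases mul_eq_zero.1 h3 with h3 | h3
    · exact .inl ((isRad_of_E_mul h1 h3).eq_zero_of_idem hf')
    · exact .inr ((isRad_of_E_mul h2 h3).eq_zero_of_idem hg')

/-- A homomorphism `E i A → E j A` with `i ≠ j` has its image in the radical. -/
lemma eq_of_equiv (i j : Fin n)
    (h : Nonempty (rightIdeal (Z.idem i) ≃ₗ[Aᵐᵒᵖ] rightIdeal (Z.idem j))) : i = j := by
  obtain ⟨φ⟩ := h
  by_contra hij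
  let s : rightIdeal (Z.idem i) := ⟨Z.E i, self_mem_rightIdeal _⟩
  have h1 : Z.E j * (φ s : A) = φ s := (mem_rightIdeal_of_idem (Z.E_mul_E_self j)).1 (φ s).2
  have h2 : (φ s : A) * Z.E i = φ s := by
    have : MulOpposite.op (Z.E i) • s = s := Subtype.ext (Z.E_mul_E_self i)
    exact congrArg Subtype.val ((φ.map_smul (MulOpposite.op (Z.E i)) s).symm.trans
      (congrArg φ this))
  have h3 : Z.IsRad (φ s : A) := isRad_of_E_mul h1 (by
    rw [← h2, ε_mul_E, if_neg]
    rwa [Fin.val_inj, eq_comm])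
  obtain ⟨⟨t, ht⟩, hφ⟩ := φ.surjective ⟨Z.E j, self_mem_rightIdeal _⟩
  obtain ⟨y, rfl⟩ := mem_rightIdeal.1 ht
  have h4 : (φ s : A) * y = Z.E j := by
    have : MulOpposite.op y • s = ⟨Z.idem i * y, ht⟩ := rfl
    rw [← this, map_smul] at hφ
    exact congrArg Subtype.val hφ
  have h5 := h3.mul_right y j
  rw [h4, Z.ε_E_self j.2] at h5
  exact one_ne_zero h5

lemma isIdempotentSequence : IsIdempotentSequence Z.idem :=
  ⟨Z.completeOrthogonalIdempotents, Z.isPrimitiveIdempotentElem, Z.eq_of_equiv⟩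

/-- The proper standard module at `i` is `E i A / a i A`, since the radical paths from `i` to
vertices `k` with `i ≤ k` are `a i` and `c i = a i * b i`. -/
lemma properStandardKernel_eq (i : Fin n) :
    properStandardKernel Z.idem i = rightIdeal (Z.a i) := by
  apply le_antisymm
  · refine Submodule.span_le.2 ?_
    rintro x ⟨y, hy, rfl⟩
    have hy := Z.mem_jacobson_iff.1 hy
    change Z.E i * y * ∑ k ∈ Finset.Ici i, Z.E k ∈ rightIdeal (Z.a i)
    rw [mem_rightIdeal_a]
    refine ⟨by simp [← mul_assoc], ((hy.mul_left _).mul_right _) _, fun j hj => ?_⟩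
    rw [Finset.mul_sum, map_sum]
    refine Finset.sum_eq_zero fun k hk => ?_
    have hik : i ≤ k := Finset.mem_Ici.1 hk
    have : (i : ℕ) ≤ k := hik
    rw [β_mul_E, if_neg (by omega)]
  · rw [Submodule.span_singleton_le_iff_mem]
    by_cases hi : (i : ℕ) + 1 < n
    · refine Submodule.subset_span ⟨Z.a i, Z.mem_jacobson_iff.2 fun k => by simp, ?_⟩
      change Z.a i = Z.E i * Z.a i * ∑ k ∈ Finset.Ici i, Z.E k
      rw [E_mul_a, Finset.mul_sum, Finset.sum_eq_single ⟨i + 1, hi⟩]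
      · rw [a_mul_E]
      · intro k _ hk
        have hk : (k : ℕ) ≠ i + 1 := fun h => hk (Fin.ext h)
        rw [← a_mul_E, mul_assoc, E_mul_E, if_neg hk.symm, mul_zero]
      · intro h
        exact absurd (Finset.mem_Ici.2 (Fin.mk_le_mk.2 (Nat.le_succ _))) h
    · rw [Z.a_eq_zero _ (by omega)]
      exact zero_mem _

/-- Recognition of proper standard modules as subquotients of the regular module: left
multiplication by `g` maps `E i A` onto `N' / N` with the kernel `a i A`. -/
lemma nonempty_equiv_properStandard {N N' : Submodule Aᵐᵒᵖ A} (i : Fin n) (g : A)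
    (h1 : ∀ x, Z.E i * x = x → g * x ∈ N')
    (h2 : ∀ z ∈ N', ∃ x, Z.E i * x = x ∧ z - g * x ∈ N)
    (h3 : ∀ x, Z.E i * x = x → (g * x ∈ N ↔ x ∈ rightIdeal (Z.a i))) :
    Nonempty ((N' ⧸ N.submoduleOf N') ≃ₗ[Aᵐᵒᵖ]
      ModuleCat.of Aᵐᵒᵖ (ProperStandard Z.idem i)) := by
  have hE {x : A} : x ∈ rightIdeal (Z.idem i) ↔ Z.E i * x = x :=
    mem_rightIdeal_of_idem (Z.E_mul_E_self i)
  let F : rightIdeal (Z.idem i) →ₗ[Aᵐᵒᵖ] N' ⧸ N.submoduleOf N' :=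
    (N.submoduleOf N').mkQ ∘ₗ LinearMap.codRestrict N' (orbitMap g ∘ₗ Submodule.subtype _)
      fun x => h1 x (hE.1 x.2)
  have hF : Function.Surjective F := fun q => by
    obtain ⟨⟨z, hz⟩, rfl⟩ := Submodule.Quotient.mk_surjective _ q
    obtain ⟨x, hx, hzx⟩ := h2 z hz
    exact ⟨⟨x, hE.2 hx⟩, ((Submodule.Quotient.eq (N.submoduleOf N')).2 hzx).symm⟩
  have hker : (properStandardKernel Z.idem i).submoduleOf (rightIdeal (Z.idem i)) =
      LinearMap.ker F := by
    rw [properStandardKernel_eq]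
    ext x
    rw [LinearMap.mem_ker]
    exact (h3 x (hE.1 x.2)).symm.trans (Submodule.Quotient.mk_eq_zero (N.submoduleOf N')
      (x := ⟨g * x, h1 x (hE.1 x.2)⟩)).symm
  exact ⟨((Submodule.quotEquivOfEq _ _ hker).trans (LinearMap.quotKerEquivOfSurjective F hF)).symm⟩

/-- The sum of the right ideals at the vertices below `j`. -/
def initialIdeal (j : ℕ) : Submodule Aᵐᵒᵖ A where
  carrier := {x | ∀ i, j ≤ i → Z.E i * x = 0}
  add_mem' hx hy i hi := by rw [mul_add, hx i hi, hy i hi, add_zero]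
  zero_mem' i _ := mul_zero _
  smul_mem' r x hx i hi := by
    change Z.E i * (x * r.unop) = 0
    rw [← mul_assoc, hx i hi, zero_mul]

/-- The sum of the right ideals at the vertices below `j` and of `a j A`. -/
def intermediateIdeal (j : ℕ) : Submodule Aᵐᵒᵖ A where
  carrier := {x | (∀ i, j < i → Z.E i * x = 0) ∧ Z.E j * x ∈ rightIdeal (Z.a j)}
  add_mem' hx hy := ⟨fun i hi => by rw [mul_add, hx.1 i hi, hy.1 i hi, add_zero],
    by rw [mul_add]; exact add_mem hx.2 hy.2⟩
  zero_mem' := ⟨fun i _ => mul_zero _, by rw [mul_zero]; exact zero_mem _⟩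
  smul_mem' r x hx := ⟨fun i hi => by
    change Z.E i * (x * r.unop) = 0
    rw [← mul_assoc, hx.1 i hi, zero_mul], by
    change Z.E j * (x * r.unop) ∈ _
    rw [← mul_assoc]
    exact Submodule.smul_mem _ r hx.2⟩

lemma E_mul_E_mul {i j : ℕ} (h : i ≠ j) (x : A) : Z.E i * (Z.E j * x) = 0 := by
  rw [← mul_assoc, E_mul_E, if_neg h, zero_mul]

lemma E_mul_E_mul_self (i : ℕ) (x : A) : Z.E i * (Z.E i * x) = Z.E i * x := by
  rw [← mul_assoc, E_mul_E_self]

lemma E_mul_a_mul {i j : ℕ} (h : i ≠ j) (x : A) : Z.E i * (Z.a j * x) = 0 := by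
  rw [← Z.E_mul_a j, mul_assoc, E_mul_E_mul _ h]

/-- Left multiplication by `a j` identifies the proper standard module at `j + 1` with `a j A`. At
the last vertex `a j = 0`, and nothing is added. -/
lemma hasChainTo_intermediate {j : ℕ} (hj : j < n)
    (h : HasChainTo (fun i => ModuleCat.of Aᵐᵒᵖ (ProperStandard Z.idem i)) (Z.initialIdeal j)) :
    HasChainTo (fun i => ModuleCat.of Aᵐᵒᵖ (ProperStandard Z.idem i)) (Z.intermediateIdeal j) := by
  by_cases hj' : j + 1 < n
  · refine h.step (fun x hx => ⟨fun i hi => hx i hi.le, by rw [hx j le_rfl]; exact zero_mem _⟩)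
      (Z.nonempty_equiv_properStandard ⟨j + 1, hj'⟩ (Z.a j) (fun x _ => ⟨fun i hi => ?_, ?_⟩)
        (fun z hz => ?_) (fun x hx => ?_))
    · exact Z.E_mul_a_mul (by omega) x
    · rw [← mul_assoc, E_mul_a]
      exact mul_mem_rightIdeal _ _
    · obtain ⟨y, hy⟩ := mem_rightIdeal.1 hz.2
      refine ⟨Z.E (j + 1) * y, Z.E_mul_E_mul_self _ _, fun i hi => ?_⟩
      rw [← mul_assoc (Z.a j), a_mul_E, hy, mul_sub]
      rcases eq_or_lt_of_le hi with rfl | hi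
      · rw [E_mul_E_mul_self, sub_self]
      · rw [hz.1 i hi, E_mul_E_mul _ (by omega), sub_zero]
    · rw [← Z.a_mul_eq_zero_iff hx]
      constructor
      · intro h
        have := h j le_rfl
        rwa [← mul_assoc, E_mul_a] at this
      · intro h
        rw [h]
        exact zero_mem _
  · convert h using 1
    ext x
    have ha : rightIdeal (Z.a j) = ⊥ := by
      rw [Z.a_eq_zero j (by omega), Submodule.span_singleton_eq_bot]
    constructor
    · rintro ⟨h1, h2⟩ i hi
      rcases eq_or_lt_of_le hi with rfl | hi
      · rwa [ha] at h2
      · exact h1 i hi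
    · intro hx
      exact ⟨fun i hi => hx i hi.le, by rw [hx j le_rfl]; exact zero_mem _⟩

/-- The next subquotient is `E j A / a j A`. -/
lemma hasChainTo_succ {j : ℕ} (hj : j < n)
    (h : HasChainTo (fun i => ModuleCat.of Aᵐᵒᵖ (ProperStandard Z.idem i))
      (Z.intermediateIdeal j)) :
    HasChainTo (fun i => ModuleCat.of Aᵐᵒᵖ (ProperStandard Z.idem i)) (Z.initialIdeal (j + 1)) := by
  refine h.step (fun x hx i hi => hx.1 i hi)
    (Z.nonempty_equiv_properStandard ⟨j, hj⟩ (Z.E j) (fun x _ i hi => ?_)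
      (fun z hz => ⟨Z.E j * z, Z.E_mul_E_mul_self _ _, fun i hi => ?_, ?_⟩) (fun x hx => ?_))
  · exact Z.E_mul_E_mul (by omega) x
  · rw [E_mul_E_mul_self, mul_sub, hz i hi, E_mul_E_mul _ (by omega), sub_zero]
  · rw [E_mul_E_mul_self, mul_sub, E_mul_E_mul_self, sub_self]
    exact zero_mem _
  · change Z.E j * x = x at hx
    rw [hx]
    constructor
    · intro h
      rw [← hx]
      exact h.2
    · intro h
      refine ⟨fun i hi => ?_, by rwa [hx]⟩
      rw [← hx, E_mul_E_mul _ (by omega)]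

theorem isStandardlyStratified : IsStandardlyStratified Z.idem := by
  have h (j : ℕ) (hj : j ≤ n) : HasChainTo
      (fun i => ModuleCat.of Aᵐᵒᵖ (ProperStandard Z.idem i)) (Z.initialIdeal j) := by
    induction j with
    | zero =>
      convert hasChainTo_bot
      rw [eq_bot_iff]
      intro x hx
      rw [Submodule.mem_bot, ← one_mul x, ← Z.sum_E, Finset.sum_mul]
      exact Finset.sum_eq_zero fun i _ => hx i i.zero_le
    | succ j ih => exact Z.hasChainTo_succ hj (Z.hasChainTo_intermediate hj (ih (by omega)))
  have htop : Z.initialIdeal n = ⊤ := by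
    rw [eq_top_iff]
    intro x _ i hi
    rw [Z.E_eq_zero i hi, zero_mul]
  have := h n le_rfl
  rw [htop] at this
  exact this

theorem isQuasiHereditary {K : Type u} [Field K] {n : ℕ} {A : Type u} [Ring A] [Algebra K A]
    (Z : ZigzagCoordinates K n A) (hn : 2 ≤ n) : IsQuasiHereditary A :=
  ⟨⟨n, Z.idem, Z.isIdempotentSequence, Z.isStandardlyStratified⟩, Z.hasFiniteGlobalDimension hn⟩

theorem nontrivial {K : Type u} [Field K] {n : ℕ} {A : Type u} [Ring A] [Algebra K A]
    (Z : ZigzagCoordinates K n A) (hn : 0 < n) : Nontrivial A :=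
  ⟨1, 0, fun h => by
    have := congrArg (Z.ε 0) h
    rw [Z.ε_one 0 hn, map_zero] at this
    exact one_ne_zero this⟩

/-- Commuting with the arrows `a i` forces the coefficients of a central element at all trivial
paths to agree. For an idempotent they are all `0` or all `1`, so that `c` or `1 - c` is a radical
idempotent. -/
theorem eq_zero_or_one_of_central {K : Type u} [Field K] {n : ℕ} {A : Type u} [Ring A]
    [Algebra K A] (Z : ZigzagCoordinates K n A) {c : A} (hc : c ∈ Set.center A)
    (hi : IsIdempotentElem c) :
    c = 0 ∨ c = 1 := by
  have hc' (x : A) : c * x = x * c := (Set.mem_center_iff.1 hc).comm x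
  have hconst (i : ℕ) (hi : i < n) : Z.ε i c = Z.ε 0 c := by
    induction i with
    | zero => rfl
    | succ i ih =>
      rw [← ih (by omega)]
      simpa [hi] using congrArg (Z.α i) (hc' (Z.a i)).symm
  have h0 : Z.ε 0 c * (1 - Z.ε 0 c) = 0 := by
    have := congrArg (Z.ε 0) (show c * c = c from hi)
    rw [ε_mul] at this
    linear_combination -this
  have hrad {x : A} (hx : ∀ i < n, Z.ε i x = 0) : Z.IsRad x := fun i => by
    by_cases h : i < n
    · exact hx i h
    · exact Z.ε_eq_zero i x (by omega)
  rcases mul_eq_zero.1 h0 with h | h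
  · exact .inl ((hrad fun i hi => by rw [hconst i hi, h]).eq_zero_of_idem hi)
  · refine .inr (sub_eq_zero.1
      ((hrad (x := 1 - c) fun i hi => ?_).eq_zero_of_idem hi.one_sub)).symm
    rw [map_sub, hconst i hi, Z.ε_one i hi, h]

theorem not_isSemisimpleRing {K : Type u} [Field K] {n : ℕ} {A : Type u} [Ring A] [Algebra K A]
    (Z : ZigzagCoordinates K n A) (hn : 2 ≤ n) : ¬ IsSemisimpleRing A := by
  intro h
  have h1 : Z.a 0 ∈ Ring.jacobson A := Z.mem_jacobson_iff.2 fun i => by simp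
  rw [IsSemisimpleRing.jacobson_eq_bot, Submodule.mem_bot] at h1
  have := congrArg (Z.α 0) h1
  simp at this
  omega

end ZigzagCoordinates

/-! ### The simple-preserving duality -/

namespace ZigzagCoordinates

variable {K : Type u} [Field K] {n : ℕ} {A : Type u} [Ring A] [Algebra K A]
  (Z : ZigzagCoordinates K n A)

/-- The anti-involution that fixes the trivial paths and exchanges `a i` and `b i`. -/
def flip : A →ₗ[K] A where
  toFun x := Z.mk (Z.ε · x) (Z.β · x) (Z.α · x) (Z.γ · x)
  map_add' x y := by
    refine Z.ext' fun i => ?_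
    simp
    grind
  map_smul' r x := by
    refine Z.ext' fun i => ?_
    simp

@[simp] lemma ε_flip (i : ℕ) (x : A) : Z.ε i (Z.flip x) = Z.ε i x := by
  have := Z.ε_eq_zero i x
  simp [flip]; grind
@[simp] lemma α_flip (i : ℕ) (x : A) : Z.α i (Z.flip x) = Z.β i x := by
  have := Z.β_eq_zero i x
  simp [flip]; grind
@[simp] lemma β_flip (i : ℕ) (x : A) : Z.β i (Z.flip x) = Z.α i x := by
  have := Z.α_eq_zero i x
  simp [flip]; grind
@[simp] lemma γ_flip (i : ℕ) (x : A) : Z.γ i (Z.flip x) = Z.γ i x := by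
  have := Z.γ_eq_zero i x
  simp [flip]; grind

@[simp] lemma flip_flip (x : A) : Z.flip (Z.flip x) = x :=
  Z.ext' fun i => by simp

@[simp] lemma flip_one : Z.flip 1 = 1 :=
  Z.ext' fun i => by simp

lemma flip_mul (x y : A) : Z.flip (x * y) = Z.flip y * Z.flip x := by
  refine Z.ext' fun i => ⟨?_, ?_, ?_, ?_⟩
  · simp [ε_mul, mul_comm]
  · simp [α_mul, β_mul]; ring
  · simp [α_mul, β_mul]; ring
  · cases i <;> simp [γ_mul_zero, γ_mul_succ]
    · congr 1
      ring_nf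
    · congr 1
      ring_nf

@[simp] lemma flip_algebraMap (r : K) : Z.flip (algebraMap K A r) = algebraMap K A r := by
  rw [Algebra.algebraMap_eq_smul_one, map_smul, flip_one]

variable (K A) in
/-- The `K`-linear functionals on a right `A`-module. They are encoded as additive maps with a
condition, because a right `A`-module comes without a `K`-module structure of its own. -/
def functionals (M : Type u) [AddCommGroup M] [Module Aᵐᵒᵖ M] : AddSubgroup (M →+ K) where
  carrier := {φ | ∀ (r : K) (x : M), φ (MulOpposite.op (algebraMap K A r) • x) = r * φ x}
  add_mem' hφ hψ r x := by simp [hφ r x, hψ r x, mul_add]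
  zero_mem' r x := by simp
  neg_mem' hφ r x := by simp [hφ r x]

/-- The dual of a right module, made into a right module through the anti-involution. -/
def FlipDual (_ : ZigzagCoordinates K n A) (M : Type u) [AddCommGroup M] [Module Aᵐᵒᵖ M] :
    Type u :=
  functionals K A M

namespace FlipDual

variable {Z} {M N : Type u} [AddCommGroup M] [Module Aᵐᵒᵖ M] [AddCommGroup N] [Module Aᵐᵒᵖ N]

instance : AddCommGroup (Z.FlipDual M) := inferInstanceAs (AddCommGroup (functionals K A M))

instance : FunLike (Z.FlipDual M) M K where
  coe φ := φ.1
  coe_injective _ _ h := Subtype.ext (DFunLike.coe_injective h)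

instance : AddMonoidHomClass (Z.FlipDual M) M K where
  map_add φ := φ.1.map_add
  map_zero φ := φ.1.map_zero

@[ext] lemma ext {φ ψ : Z.FlipDual M} (h : ∀ x, φ x = ψ x) : φ = ψ := DFunLike.ext _ _ h

@[simp] lemma add_apply (φ ψ : Z.FlipDual M) (x : M) : (φ + ψ) x = φ x + ψ x := rfl

lemma map_op_smul (φ : Z.FlipDual M) (r : K) (x : M) :
    φ (MulOpposite.op (algebraMap K A r) • x) = r * φ x := φ.2 r x

instance : Module Aᵐᵒᵖ (Z.FlipDual M) where
  smul y φ := ⟨φ.1.comp (DistribSMul.toAddMonoidHom M (MulOpposite.op (Z.flip y.unop))),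
    fun r x => by
      change φ (MulOpposite.op (Z.flip y.unop) • MulOpposite.op (algebraMap K A r) • x) =
        r * φ (MulOpposite.op (Z.flip y.unop) • x)
      rw [smul_smul, ← MulOpposite.op_mul, Algebra.commutes, MulOpposite.op_mul, mul_smul,
        map_op_smul]⟩
  one_smul φ := ext fun x => by
    change φ (MulOpposite.op (Z.flip 1) • x) = φ x
    rw [flip_one, MulOpposite.op_one, one_smul]
  mul_smul y z φ := ext fun x => by
    change φ (MulOpposite.op (Z.flip (z.unop * y.unop)) • x) =
      φ (MulOpposite.op (Z.flip z.unop) • MulOpposite.op (Z.flip y.unop) • x)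
    rw [flip_mul, MulOpposite.op_mul, mul_smul]
  smul_zero _ := rfl
  smul_add _ _ _ := rfl
  add_smul y z φ := ext fun x => by
    change φ (MulOpposite.op (Z.flip (y.unop + z.unop)) • x) =
      φ (MulOpposite.op (Z.flip y.unop) • x) + φ (MulOpposite.op (Z.flip z.unop) • x)
    rw [map_add, MulOpposite.op_add, add_smul, map_add]
  zero_smul φ := ext fun x => by
    change φ (MulOpposite.op (Z.flip 0) • x) = 0
    rw [map_zero, MulOpposite.op_zero, zero_smul, map_zero]

@[simp] lemma smul_apply (y : Aᵐᵒᵖ) (φ : Z.FlipDual M) (x : M) :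
    (y • φ) x = φ (MulOpposite.op (Z.flip y.unop) • x) := rfl

variable (Z) in
/-- Precomposition with a module homomorphism. -/
def map (f : M →ₗ[Aᵐᵒᵖ] N) : Z.FlipDual N →ₗ[Aᵐᵒᵖ] Z.FlipDual M where
  toFun φ := ⟨φ.1.comp f.toAddMonoidHom, fun r x => by
    change φ (f _) = r * φ (f x)
    rw [map_smul, map_op_smul]⟩
  map_add' φ ψ := rfl
  map_smul' y φ := ext fun x => congrArg φ (f.map_smul _ x).symm

variable (Z M) in
/-- `FlipDual` as the dual vector space, for the `K`-module structures induced by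
`algebraMap K A`. -/
def equivDual : letI := Module.restrictScalars K Aᵐᵒᵖ M
    letI := Module.restrictScalars K Aᵐᵒᵖ (Z.FlipDual M)
    Z.FlipDual M ≃ₗ[K] Module.Dual K M :=
  letI := Module.restrictScalars K Aᵐᵒᵖ M
  letI := Module.restrictScalars K Aᵐᵒᵖ (Z.FlipDual M)
  { toFun φ := { toFun := φ, map_add' := map_add φ, map_smul' := fun r x => φ.2 r x }
    invFun φ := ⟨φ.toAddMonoidHom, fun r x => φ.map_smul r x⟩
    map_add' φ ψ := rfl
    map_smul' r φ := LinearMap.ext fun x => by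
      change φ (MulOpposite.op (Z.flip (algebraMap K A r)) • x) = r * φ x
      rw [flip_algebraMap, map_op_smul]
    left_inv φ := rfl
    right_inv φ := rfl }

lemma finite_restrictScalars (Z : ZigzagCoordinates K n A) (M : Type u) [AddCommGroup M]
    [Module Aᵐᵒᵖ M] [Module.Finite Aᵐᵒᵖ M] :
    letI := Module.restrictScalars K Aᵐᵒᵖ M; Module.Finite K M := by
  let _ := Module.restrictScalars K Aᵐᵒᵖ M
  have : IsScalarTower K Aᵐᵒᵖ M := IsScalarTower.restrictScalars K Aᵐᵒᵖ M
  have := Z.finiteDimensional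
  exact Module.Finite.trans Aᵐᵒᵖ M

instance [Module.Finite Aᵐᵒᵖ M] : Module.Finite Aᵐᵒᵖ (Z.FlipDual M) := by
  let _ := Module.restrictScalars K Aᵐᵒᵖ M
  let _ := Module.restrictScalars K Aᵐᵒᵖ (Z.FlipDual M)
  have : IsScalarTower K Aᵐᵒᵖ (Z.FlipDual M) := IsScalarTower.restrictScalars K Aᵐᵒᵖ _
  have := finite_restrictScalars Z M
  have : Module.Finite K (Z.FlipDual M) := Module.Finite.equiv (equivDual Z M).symm
  exact Module.Finite.of_restrictScalars_finite K Aᵐᵒᵖ _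

variable (Z M) in
/-- The evaluation map to the double dual; it is a homomorphism since the anti-involution is an
involution. -/
def eval : M →ₗ[Aᵐᵒᵖ] Z.FlipDual (Z.FlipDual M) where
  toFun x := ⟨⟨⟨fun φ => φ x, rfl⟩, fun φ ψ => rfl⟩, fun r φ => by
    change φ (MulOpposite.op (Z.flip (algebraMap K A r)) • x) = r * φ x
    rw [flip_algebraMap, map_op_smul]⟩
  map_add' x y := ext fun φ => map_add φ x y
  map_smul' y x := ext fun φ => by
    change φ (y • x) = φ (MulOpposite.op (Z.flip (Z.flip y.unop)) • x)
    rw [flip_flip, MulOpposite.op_unop]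

lemma eval_bijective [Module.Finite Aᵐᵒᵖ M] : Function.Bijective (eval Z M) := by
  let _ := Module.restrictScalars K Aᵐᵒᵖ M
  let _ := Module.restrictScalars K Aᵐᵒᵖ (Z.FlipDual M)
  have := finite_restrictScalars Z M
  constructor
  · rw [← LinearMap.ker_eq_bot, LinearMap.ker_eq_bot']
    intro x hx
    refine (Module.forall_dual_apply_eq_zero_iff K x).1 fun φ => ?_
    exact DFunLike.congr_fun hx ((equivDual Z M).symm φ)
  · intro Ψ
    obtain ⟨x, hx⟩ := (Module.evalEquiv K M).surjective
      (equivDual Z (Z.FlipDual M) Ψ ∘ₗ (equivDual Z M).symm.toLinearMap)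
    exact ⟨x, ext fun φ => LinearMap.congr_fun hx (equivDual Z M φ)⟩

end FlipDual

/-- The functor that sends a finitely generated right module to its dual. -/
def duality : (FGModuleCat.{u} Aᵐᵒᵖ)ᵒᵖ ⥤ FGModuleCat.{u} Aᵐᵒᵖ where
  obj M := FGModuleCat.of Aᵐᵒᵖ (Z.FlipDual M.unop)
  map f := FGModuleCat.ofHom (FlipDual.map Z f.unop.hom.hom)
  map_id _ := rfl
  map_comp _ _ := rfl

/-- The natural isomorphism given by evaluation. -/
noncomputable def dualityIso : Z.duality.rightOp ⋙ Z.duality ≅ 𝟭 (FGModuleCat.{u} Aᵐᵒᵖ) :=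
  (NatIso.ofComponents (F := 𝟭 (FGModuleCat.{u} Aᵐᵒᵖ)) (G := Z.duality.rightOp ⋙ Z.duality)
    (fun M => (LinearEquiv.ofBijective (FlipDual.eval Z M)
      FlipDual.eval_bijective).toFGModuleCatIso) (fun _ => rfl)).symm

/-- The dual of the simple module `S` at `i`, generated by `s`, is generated by the functional `l`
with `l (s * x) = ε i x`. -/
lemma isSimpleAt_flipDual {i : ℕ} (hi : i < n) {S : Type u} [AddCommGroup S] [Module Aᵐᵒᵖ S]
    (hS : Z.IsSimpleAt i S) : Z.IsSimpleAt i (Z.FlipDual S) := by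
  obtain ⟨s, hs, hs'⟩ := hS
  have key (x y : A) (h : MulOpposite.op x • s = MulOpposite.op y • s) : Z.ε i x = Z.ε i y := by
    rw [← sub_eq_zero, ← map_sub, ← hs', MulOpposite.op_sub, sub_smul, h, sub_self]
  choose p hp using hs
  have hp' (x : A) : Z.ε i (p (MulOpposite.op x • s)) = Z.ε i x := key _ _ (hp _)
  have hop (x y : A) : MulOpposite.op x • MulOpposite.op y • s = MulOpposite.op (y * x) • s := by
    rw [MulOpposite.op_mul, mul_smul]
  let l : Z.FlipDual S := ⟨⟨⟨fun t => Z.ε i (p t), by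
      have h0 := hp' 0
      rwa [MulOpposite.op_zero, zero_smul, map_zero] at h0⟩, fun t t' => by
      change Z.ε i (p (t + t')) = Z.ε i (p t) + Z.ε i (p t')
      rw [← map_add, ← hp' (p t + p t'), MulOpposite.op_add, add_smul]
      exact congrArg _ (congrArg _ (congrArg₂ _ (hp t).symm (hp t').symm))⟩, fun r t => by
      change Z.ε i (p (_ • t)) = r * Z.ε i (p t)
      obtain ⟨x, rfl⟩ : ∃ x : A, MulOpposite.op x • s = t := ⟨p t, hp t⟩
      rw [hop, hp', hp', ε_mul, Algebra.algebraMap_eq_smul_one, map_smul, Z.ε_one i hi, smul_eq_mul]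
      ring⟩
  have hl (x : A) : l (MulOpposite.op x • s) = Z.ε i x := hp' x
  refine ⟨l, fun φ => ⟨algebraMap K A (φ s), FlipDual.ext fun t => ?_⟩, fun x => ?_⟩
  · obtain ⟨x, rfl⟩ : ∃ x : A, MulOpposite.op x • s = t := ⟨p t, hp t⟩
    have h1 : MulOpposite.op x • s = MulOpposite.op (algebraMap K A (Z.ε i x)) • s := by
      rw [← sub_eq_zero, ← sub_smul, ← MulOpposite.op_sub, hs', map_sub,
        Algebra.algebraMap_eq_smul_one, map_smul, Z.ε_one i hi]
      simp
    rw [orbitMap_apply, FlipDual.smul_apply, MulOpposite.unop_op, flip_algebraMap,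
      FlipDual.map_op_smul, hl, h1, FlipDual.map_op_smul, mul_comm]
  · constructor
    · intro h
      have := DFunLike.congr_fun h s
      rwa [FlipDual.smul_apply, MulOpposite.unop_op, hl, ε_flip] at this
    · intro h
      refine FlipDual.ext fun t => ?_
      obtain ⟨y, rfl⟩ : ∃ y : A, MulOpposite.op y • s = t := ⟨p t, hp t⟩
      rw [FlipDual.smul_apply, MulOpposite.unop_op, hop, hl, ε_mul, ε_flip, h, mul_zero]
      rfl

theorem isSimplePreservingDuality : IsSimplePreservingDuality K A Z.duality where
  map_add {_ N} f g := by
    refine FGModuleCat.hom_ext (LinearMap.ext fun (φ : Z.FlipDual N) => ?_)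
    refine FlipDual.ext (Z := Z) fun x => ?_
    exact map_add φ (f.hom.hom x) (g.hom.hom x)
  map_smul {_ N} c f := by
    refine FGModuleCat.hom_ext (LinearMap.ext fun (φ : Z.FlipDual N) => ?_)
    refine FlipDual.ext (Z := Z) fun x => ?_
    change φ (MulOpposite.op (algebraMap K A c) • f.hom.hom x) =
      φ (f.hom.hom (MulOpposite.op (Z.flip (algebraMap K A c)) • x))
    rw [flip_algebraMap]
    exact congrArg φ (f.hom.hom.map_smul _ x).symm
  involutive := ⟨Z.dualityIso⟩
  simple S hS := by
    obtain ⟨i, hi, h⟩ := Z.exists_isSimpleAt hS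
    obtain ⟨e⟩ := (Z.isSimpleAt_flipDual hi h).equiv h
    exact ⟨e.toFGModuleCatIso⟩

end ZigzagCoordinates

theorem mainTheorem6 (K : Type u) [Field K] [IsAlgClosed K] (n : ℕ) (hn : 2 ≤ n) :
    dominantDimension (QuiverAlgebraB K n (fun _ => 1)) = ((2 * n - 2 : ℕ) : ℕ∞) ∧
      IsInClassA K (QuiverAlgebraB K n (fun _ => 1)) := by
  obtain ⟨m, rfl⟩ : ∃ m, n = m + 2 := ⟨n - 2, by omega⟩
  let Z := QuiverAlgebraB.coordinates K (m + 2)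
  have hdom := Z.dominantDimension_eq
  refine ⟨by rw [hdom, show 2 * (m + 2) - 2 = 2 * m + 2 by omega], ?_⟩
  exact
    { finiteDimensional := Z.finiteDimensional
      nontrivial := Z.nontrivial (by omega)
      connected := fun _ hc hi => Z.eq_zero_or_one_of_central hc hi
      not_semisimple := Z.not_isSemisimpleRing hn
      quasiHereditary := Z.isQuasiHereditary hn
      duality := ⟨Z.duality, Z.isSimplePreservingDuality⟩
      two_le_dominantDimension := by
        rw [hdom]
        exact_mod_cast Nat.le_add_left 2 (2 * m) }
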